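/- Let $\lambda,\mu>0$ and let $G=\{G(t),t\ge 0\}$ be the continuous-time Markov chain on finite rooted trees with $G(0)$ a single vertex (the root), in which a new leaf is attached to each vertex at rate $\lambda$ and each leaf other than the root is deleted at rate $\mu$. Let $H(t)$ be the height of $G(t)$, i.e. the maximal distance of a vertex from the root. Put $\rho=\lambda/\mu$ and, for $\rho\le e^{-1}$, let $r\in(0,1]$ be the smallest root of $re^{-r}=\rho$. 1. If $\rho\le e^{-1}$, then $H(t)$ converges in distribution, as $t\to\infty$, to a random variable $H$ with values in $\{0,1,2,\dots\}$ (the stationary height), and $$P\{H=0\}=e^{-r},\qquad P\{H>h+1\}=1-\exp\bigl(-r\,P\{H>h\}\bigr)\quad\text{for all integers } h\ge 0 .$$ 2. For every $r\in(0,1)$ there is one and only one function $x\mapsto\theta(r,x)$ on $[0,\infty)$ that extends analytically to a neighbourhood of $[0,\infty)$ and satisfies the Schröder equation $\theta(r,1-e^{-rx})=r\,\theta(r,x)$ for $x\ge 0$ together with $\frac{\partial\theta}{\partial x}(r,0)=1$; moreover $\theta(r,1)>0$. If $\rho<e^{-1}$, then $$P\{H>h\}=\theta(r,1)\,r^{h+1}+O\Bigl(\frac{r^{2h}}{1-r}\Bigr),\qquad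 h\ge 0,$$ where the constant in $O(\cdot)$ is absolute (independent of $h$, $\lambda$ and $\mu$). 3. If $\rho=e^{-1}$, then $$P\{H>h\}=\frac 2h+O\Bigl(\frac{\log h}{h^2}\Bigr),\qquad h\ge 2,$$ where the constant in $O(\cdot)$ is absolute. -/

import Mathlib

open MeasureTheory ProbabilityTheory Filter Topology Set
open scoped NNReal

/-- Finite rooted trees: a tree is a root together with the finite list of the subtrees hanging
from the children of the root. The children of a vertex are listed from the youngest to the
oldest, so that a list of subtrees records nothing but the tree and the order of births. -/
inductive RTree : Type
  | node : List RTree → RTree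

namespace RTree

/-- The tree that consists of a single vertex. -/
def single : RTree := node []

mutual

/-- The height of a tree: the largest distance of a vertex from the root. -/
def height : RTree → ℕ
  | node l => heightForest l

/-- The height of the tree whose root carries the given list of subtrees. -/
def heightForest : List RTree → ℕ
  | [] => 0
  | t :: l => max (height t + 1) (heightForest l)

end

mutual

/-- The trees that arise from a tree by one adjunction, with one entry for each vertex `v` of the
tree: the entry is the tree in which a new leaf is attached to `v`. -/
def adjunctions : RTree → List RTree
  | node l => node (single :: l) :: (adjunctionsForest l).map node

/-- Adjunctions at the vertices of a list of trees, one entry for each vertex. -/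
def adjunctionsForest : List RTree → List (List RTree)
  | [] => []
  | t :: l => (adjunctions t).map (fun t' => t' :: l) ++ (adjunctionsForest l).map (fun l' => t :: l')

end

mutual

/-- The trees that arise from a tree by one deletion, with one entry for each leaf `v` other than
the root: the entry is the tree in which `v` is erased. -/
def deletions : RTree → List RTree
  | node l => (deletionsForest l).map node

/-- Deletions of a leaf in a list of trees, one entry for each leaf; a member of the list that is
a single vertex is such a leaf, and its deletion removes it from the list. -/
def deletionsForest : List RTree → List (List RTree)
  | [] => []
  | node [] :: l => l :: (deletionsForest l).map (fun l' => single :: l')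
  | node (s :: k) :: l =>
      (deletions (node (s :: k))).map (fun t' => t' :: l) ++
        (deletionsForest l).map (fun l' => node (s :: k) :: l')

end

/-- The state space is discrete: every set of trees is measurable. -/
instance : MeasurableSpace RTree := ⊤

/-- The generator of the chain, applied to `f`: at every vertex a new leaf is attached at rate
`lam`, and every leaf other than the root is deleted at rate `mu`. -/
noncomputable def generator (lam mu : ℝ) (f : RTree → ℝ) (T : RTree) : ℝ :=
  lam * ((adjunctions T).map (fun T' => f T' - f T)).sum +
    mu * ((deletions T).map (fun T' => f T' - f T)).sum

end RTree

/-- `G` is (a version with right-continuous paths of) the continuous-time Markov chain on the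
finite rooted trees that starts from a single vertex, in which every vertex gives birth to a new
leaf at rate `lam` and every leaf other than the root dies at rate `mu`: it starts from the single
vertex and solves the martingale problem for the generator. -/
structure IsTreeChain {Ω : Type*} {mΩ : MeasurableSpace Ω} (P : Measure Ω) (lam mu : ℝ)
    (G : ℝ≥0 → Ω → RTree) : Prop where
  /-- The chain starts from a single vertex. -/
  start : ∀ᵐ ω ∂P, G 0 ω = RTree.single
  /-- The paths are right-continuous for the discrete topology. -/
  right_continuous : ∀ ω t, ∀ᶠ s in 𝓝[>] t, G s ω = G t ω
  /-- For a filtration to which the chain is adapted, the generator compensates every function of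
  the chain with finite support. -/
  martingale : ∃ ℱ : Filtration ℝ≥0 mΩ, (∀ t, Measurable[ℱ t] (G t)) ∧
    ∀ f : RTree → ℝ, (Function.support f).Finite →
      Martingale (fun t ω => f (G t ω) -
        ∫ s in (0 : ℝ)..t, RTree.generator lam mu f (G s.toNNReal ω)) ℱ P

/-- `φ` solves the Schröder equation `φ (1 - exp (-r x)) = r φ x` on the half-line `x ≥ 0`, is
analytic there (in a neighbourhood of each point), and satisfies `φ' 0 = 1`. -/
structure IsSchroderSolution (r : ℝ) (φ : ℝ → ℝ) : Prop where
  analytic : AnalyticOnNhd ℝ φ (Ici 0)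
  equation : ∀ x, 0 ≤ x → φ (1 - Real.exp (-(r * x))) = r * φ x
  deriv_zero : deriv φ 0 = 1

namespace RTree

mutual

/-- The number of vertices of a tree. -/
def size : RTree → ℕ
  | node l => sizeForest l + 1

/-- The number of vertices of a list of trees. -/
def sizeForest : List RTree → ℕ
  | [] => 0
  | t :: l => size t + sizeForest l

end

mutual

theorem length_adjunctions : ∀ T : RTree, (adjunctions T).length = size T
  | node l => by
    have := length_adjunctionsForest l
    simp [adjunctions, size, this]

theorem length_adjunctionsForest : ∀ l : List RTree, (adjunctionsForest l).length = sizeForest l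
  | [] => by simp [adjunctionsForest, sizeForest]
  | t :: l => by
    have h1 := length_adjunctions t
    have h2 := length_adjunctionsForest l
    simp [adjunctionsForest, sizeForest, h1, h2]

end

theorem one_le_size : ∀ T : RTree, 1 ≤ size T
  | node l => by simp [size]

mutual

theorem length_deletions_le : ∀ T : RTree, (deletions T).length ≤ size T
  | node l => by
    have := length_deletionsForest_le l
    simp only [deletions, size, List.length_map]
    omega

theorem length_deletionsForest_le :
    ∀ l : List RTree, (deletionsForest l).length ≤ sizeForest l
  | [] => by simp [deletionsForest, sizeForest]
  | node [] :: l => by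
    have h2 := length_deletionsForest_le l
    simp [deletionsForest, sizeForest, size]
    omega
  | node (s :: k) :: l => by
    have h1 := length_deletions_le (node (s :: k))
    have h2 := length_deletionsForest_le l
    simp only [deletionsForest, sizeForest, List.length_append, List.length_map]
    omega

end

mutual

theorem size_of_mem_adjunctions :
    ∀ T : RTree, ∀ T' ∈ adjunctions T, size T' = size T + 1
  | node l => by
    intro T' h
    have := size_of_mem_adjunctionsForest l
    simp only [adjunctions, List.mem_cons, List.mem_map] at h
    rcases h with rfl | ⟨l', hl', rfl⟩
    · simp [size, sizeForest, single]; omega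
    · simp [size, this l' hl']

theorem size_of_mem_adjunctionsForest :
    ∀ l : List RTree, ∀ l' ∈ adjunctionsForest l, sizeForest l' = sizeForest l + 1
  | [] => by simp [adjunctionsForest]
  | t :: l => by
    intro l' h
    have h1 := size_of_mem_adjunctions t
    have h2 := size_of_mem_adjunctionsForest l
    simp only [adjunctionsForest, List.mem_append, List.mem_map] at h
    rcases h with ⟨t', ht', rfl⟩ | ⟨k, hk, rfl⟩
    · simp [sizeForest, h1 t' ht']; omega
    · simp [sizeForest, h2 k hk]; omega

end

mutual

theorem size_of_mem_deletions :
    ∀ T : RTree, ∀ T' ∈ deletions T, size T' + 1 = size T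
  | node l => by
    intro T' h
    have := size_of_mem_deletionsForest l
    simp only [deletions, List.mem_map] at h
    rcases h with ⟨l', hl', rfl⟩
    simp [size, this l' hl']

theorem size_of_mem_deletionsForest :
    ∀ l : List RTree, ∀ l' ∈ deletionsForest l, sizeForest l' + 1 = sizeForest l
  | [] => by simp [deletionsForest]
  | node [] :: l => by
    intro l' h
    have h2 := size_of_mem_deletionsForest l
    simp only [deletionsForest, List.mem_cons, List.mem_map] at h
    rcases h with rfl | ⟨k, hk, rfl⟩
    · simp [sizeForest, size]; omega
    · have := h2 k hk
      simp [sizeForest, size, single]; omega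
  | node (s :: m) :: l => by
    intro l' h
    have h1 := size_of_mem_deletions (node (s :: m))
    have h2 := size_of_mem_deletionsForest l
    simp only [deletionsForest, List.mem_append, List.mem_map] at h
    rcases h with ⟨t', ht', rfl⟩ | ⟨k, hk, rfl⟩
    · have := h1 t' ht'
      simp only [sizeForest]; omega
    · have := h2 k hk
      simp only [sizeForest]; omega

end

theorem finite_sizeForest_le : ∀ n : ℕ, {l : List RTree | sizeForest l ≤ n}.Finite
  | 0 => by
    refine (Set.finite_singleton []).subset ?_
    rintro (_ | ⟨t, l⟩) h
    · rfl
    · have := one_le_size t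
      simp only [mem_ofPred_eq, sizeForest] at h
      omega
  | n + 1 => by
    have ih := finite_sizeForest_le n
    refine ((ih.image2 (fun k l => node k :: l) ih).union (Set.finite_singleton [])).subset ?_
    rintro (_ | ⟨⟨k⟩, l⟩) h
    · right; rfl
    · left
      simp only [mem_ofPred_eq, sizeForest, size] at h
      exact ⟨k, by simp only [mem_ofPred_eq]; omega, l, by simp only [mem_ofPred_eq]; omega, rfl⟩

theorem finite_size_le (n : ℕ) : {T : RTree | size T ≤ n}.Finite := by
  refine ((finite_sizeForest_le n).image node).subset ?_
  rintro ⟨l⟩ h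
  exact ⟨l, by simp only [mem_ofPred_eq, size] at h ⊢; omega, rfl⟩

instance : Countable RTree := by
  have : (Set.univ : Set RTree) = ⋃ n, {T | size T ≤ n} := by
    ext T; simpa using ⟨size T, le_rfl⟩
  rw [← Set.countable_univ_iff, this]
  exact Set.countable_iUnion fun n => (finite_size_le n).countable

/-- The generator of the forest process in which trees that are single vertices die at rate `mu`
and no new tree is born. -/
noncomputable def generatorForest (lam mu : ℝ) (F : List RTree → ℝ) (l : List RTree) : ℝ :=
  lam * ((adjunctionsForest l).map (fun l' => F l' - F l)).sum +
    mu * ((deletionsForest l).map (fun l' => F l' - F l)).sum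

theorem generator_node (lam mu : ℝ) (f : RTree → ℝ) (l : List RTree) :
    generator lam mu f (node l) = lam * (f (node (single :: l)) - f (node l)) +
      generatorForest lam mu (fun l => f (node l)) l := by
  simp only [generator, generatorForest, adjunctions, deletions, List.map_cons, List.map_map,
    List.sum_cons, Function.comp_def]
  ring

theorem sum_map_mul_sub (c : ℝ) {α : Type*} (L : List α) (f : α → ℝ) (x : ℝ) :
    (L.map (fun a => f a * c - x * c)).sum = (L.map (fun a => f a - x)).sum * c := by
  induction L with
  | nil => simp
  | cons a L ih => simp [ih]; ring

theorem sum_map_sub_mul (c : ℝ) {α : Type*} (L : List α) (f : α → ℝ) (x : ℝ) :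
    (L.map (fun a => c * f a - c * x)).sum = c * (L.map (fun a => f a - x)).sum := by
  induction L with
  | nil => simp
  | cons a L ih => simp [ih]; ring

open Classical in
/-- The Leibniz rule for the forest generator and a multiplicative function. -/
theorem generatorForest_cons (lam mu : ℝ) (φ : RTree → ℝ) (F : List RTree → ℝ)
    (hF : ∀ c l, F (c :: l) = φ c * F l) (c : RTree) (l : List RTree) :
    generatorForest lam mu F (c :: l) =
      (generator lam mu φ c + if c = single then mu * (1 - φ c) else 0) * F l +
        φ c * generatorForest lam mu F l := by
  rcases c with ⟨_ | ⟨s, k⟩⟩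
  · simp only [generatorForest, generator, adjunctionsForest, deletionsForest, List.map_append,
      List.map_map, Function.comp_def, hF, List.map_cons, List.sum_append, List.sum_cons,
      sum_map_mul_sub, sum_map_sub_mul, single, if_true, deletions, List.map_nil, List.sum_nil]
    ring
  · simp only [generatorForest, generator, adjunctionsForest, deletionsForest, List.map_append,
      List.map_map, Function.comp_def, hF, List.sum_append,
      sum_map_mul_sub, sum_map_sub_mul, single]
    simp
    ring

theorem generator_add (lam mu : ℝ) (f g : RTree → ℝ) (T : RTree) :
    generator lam mu (fun T => f T + g T) T = generator lam mu f T + generator lam mu g T := by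
  have key : ∀ L : List RTree, (L.map (fun T' => f T' + g T' - (f T + g T))).sum =
      (L.map (fun T' => f T' - f T)).sum + (L.map (fun T' => g T' - g T)).sum := by
    intro L
    induction L with
    | nil => simp
    | cons a L ih => simp only [List.map_cons, List.sum_cons, ih]; ring
  simp only [generator, key]
  ring

theorem generator_const_mul (lam mu c : ℝ) (f : RTree → ℝ) (T : RTree) :
    generator lam mu (fun T => c * f T) T = c * generator lam mu f T := by
  simp only [generator, sum_map_sub_mul]
  ring

theorem generator_finset_sum {ι : Type*} (lam mu : ℝ) (s : Finset ι) (f : ι → RTree → ℝ)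
    (T : RTree) :
    generator lam mu (fun T => ∑ i ∈ s, f i T) T = ∑ i ∈ s, generator lam mu (f i) T := by
  classical
  induction s using Finset.induction_on with
  | empty => simp [generator]
  | insert i s hi ih => simp only [Finset.sum_insert hi, generator_add, ih]

end RTree

section Volterra

theorem hasDerivAt_integral_moving_end {k : ℝ → ℝ → ℝ} (hk : Continuous (Function.uncurry k))
    (b : ℝ) : HasDerivAt (fun t => ∫ s in b..t, k t s) (k b b) b := by
  rw [hasDerivAt_iff_isLittleO, Asymptotics.isLittleO_iff]
  intro ε hε
  obtain ⟨δ, hδ, h⟩ := Metric.continuousAt_iff.1 (hk.continuousAt (x := (b, b))) ε hε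
  filter_upwards [Metric.ball_mem_nhds b hδ] with t ht
  have hc : Continuous (k t) := hk.comp (by fun_prop : Continuous fun s => (t, s))
  have e : (∫ s in b..t, k t s) - (∫ s in b..b, k b s) - (t - b) • k b b =
      ∫ s in b..t, (k t s - k b b) := by
    rw [intervalIntegral.integral_sub (hc.intervalIntegrable _ _) (by simp)]
    simp
  rw [e]
  refine (intervalIntegral.norm_integral_le_of_norm_le_const fun s hs => ?_)
  have hs' : dist s b ≤ dist t b := by
    rw [Real.dist_eq, Real.dist_eq]
    rcases le_total b t with hbt | hbt
    · rw [uIoc_of_le hbt] at hs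
      rw [abs_of_nonneg (by linarith [hs.1]), abs_of_nonneg (by linarith)]
      linarith [hs.2]
    · rw [uIoc_of_ge hbt] at hs
      rw [abs_of_nonpos (by linarith [hs.2]), abs_of_nonpos (by linarith)]
      linarith [hs.1]
  have := h (x := (t, s)) (by
    rw [Prod.dist_eq]; exact max_lt ht (lt_of_le_of_lt hs' ht))
  rw [Real.dist_eq] at this
  exact this.le

/-- Differentiation of an integral that depends on the variable through its integrand and its
upper end. -/
theorem hasDerivAt_integral_leibniz {k k' : ℝ → ℝ → ℝ} (hk : Continuous (Function.uncurry k))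
    (hk' : Continuous (Function.uncurry k')) (hd : ∀ t s, HasDerivAt (fun t => k t s) (k' t s) t)
    (b : ℝ) : HasDerivAt (fun t => ∫ s in (0 : ℝ)..t, k t s)
      (k b b + ∫ s in (0 : ℝ)..b, k' b s) b := by
  have hkt : ∀ t, Continuous (k t) := fun t => hk.comp (by fun_prop : Continuous fun s => (t, s))
  have hkt' : ∀ t, Continuous (k' t) :=
    fun t => hk'.comp (by fun_prop : Continuous fun s => (t, s))
  have e : (fun t => ∫ s in (0 : ℝ)..t, k t s) =
      fun t => (∫ s in b..t, k t s) + ∫ s in (0 : ℝ)..b, k t s := by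
    funext t
    rw [add_comm, intervalIntegral.integral_add_adjacent_intervals]
    · exact (hkt t).intervalIntegrable _ _
    · exact (hkt t).intervalIntegrable _ _
  rw [e]
  refine (hasDerivAt_integral_moving_end hk b).add ?_
  obtain ⟨M, hM⟩ := ((isCompact_closedBall b 1).prod
    (isCompact_uIcc (a := 0) (b := b))).exists_bound_of_continuousOn hk'.continuousOn
  refine (intervalIntegral.hasDerivAt_integral_of_dominated_loc_of_deriv_le
    (s := Metric.ball b 1) (bound := fun _ => M) (Metric.ball_mem_nhds b one_pos)
    (Eventually.of_forall fun t => (hkt t).aestronglyMeasurable)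
    ((hkt b).intervalIntegrable _ _) (hkt' b).aestronglyMeasurable
    (Eventually.of_forall fun s hs t ht => ?_) (by simp)
    (Eventually.of_forall fun s _ t _ => hd t s)).2
  exact hM (t, s) ⟨Metric.ball_subset_closedBall ht, uIoc_subset_uIcc hs⟩

/-- The convolution of two functions on the half-line. -/
noncomputable def halfConv (y U : ℝ → ℝ) (t : ℝ) : ℝ := ∫ s in (0 : ℝ)..t, y s * U (t - s)

theorem continuous_halfConv {y U : ℝ → ℝ} (hy : Continuous y) (hU : Continuous U) :
    Continuous (halfConv y U) :=
  intervalIntegral.continuous_parametric_intervalIntegral_of_continuous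
    (f := fun t s => y s * U (t - s)) (by fun_prop) continuous_id

theorem hasDerivAt_halfConv {y U U' : ℝ → ℝ} (hy : Continuous y) (hU' : Continuous U')
    (h : ∀ t, HasDerivAt U (U' t) t) (t : ℝ) :
    HasDerivAt (halfConv y U) (y t * U 0 + halfConv y U' t) t := by
  have hU : Continuous U := continuous_iff_continuousAt.2 fun t => (h t).continuousAt
  have := hasDerivAt_integral_leibniz (k := fun t s => y s * U (t - s))
    (k' := fun t s => y s * U' (t - s)) (by fun_prop) (by fun_prop)
    (fun t s => ((h (t - s)).comp_sub_const t s).const_mul (y s)) t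
  simp only [sub_self] at this
  exact this

theorem halfConv_nonneg {y U : ℝ → ℝ} {t : ℝ} (ht : 0 ≤ t) (hy : ∀ s, 0 ≤ s → 0 ≤ y s)
    (hU : ∀ s, 0 ≤ s → 0 ≤ U s) : 0 ≤ halfConv y U t :=
  intervalIntegral.integral_nonneg ht fun s hs =>
    mul_nonneg (hy s hs.1) (hU _ (by linarith [hs.2]))

theorem halfConv_mono {y z U W : ℝ → ℝ} {t : ℝ} (ht : 0 ≤ t) (hyc : Continuous y)
    (hzc : Continuous z) (hUc : Continuous U) (hWc : Continuous W)
    (h : ∀ s, 0 ≤ s → s ≤ t → y s * U (t - s) ≤ z s * W (t - s)) :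
    halfConv y U t ≤ halfConv z W t :=
  intervalIntegral.integral_mono_on ht
    ((by fun_prop : Continuous fun s => y s * U (t - s)).intervalIntegrable _ _)
    ((by fun_prop : Continuous fun s => z s * W (t - s)).intervalIntegrable _ _)
    (fun s hs => h s hs.1 hs.2)

theorem nonneg_of_deriv_nonneg_of_neg {f f' : ℝ → ℝ} (hf : ∀ t, HasDerivAt f (f' t) t)
    (h0 : 0 ≤ f 0) (h : ∀ t, 0 ≤ t → f t < 0 → 0 ≤ f' t) {t : ℝ} (ht : 0 ≤ t) : 0 ≤ f t := by
  have key : ∀ ε > 0, -f t ≤ ε * (1 + t) := by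
    intro ε hε
    refine image_le_of_deriv_right_lt_deriv_boundary (f := fun t => -f t) (f' := fun t => -f' t)
      (a := 0) (b := t) (B := fun t => ε * (1 + t)) (B' := fun _ => ε)
      (fun x _ => (hf x).continuousAt.neg.continuousWithinAt)
      (fun x _ => (hf x).neg.hasDerivWithinAt) (by simp; linarith)
      (fun x => by simpa using ((hasDerivAt_id x).const_add 1).const_mul ε) ?_ ⟨ht, le_rfl⟩
    intro x hx hfx
    have : f x < 0 := by
      have : 0 < ε * (1 + x) := mul_pos hε (by linarith [hx.1])
      linarith
    have := h x hx.1 this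
    linarith
  by_contra! hneg
  have h1 := key (-f t / (2 * (1 + t))) (div_pos (by linarith) (by linarith))
  have h2 : -f t / (2 * (1 + t)) * (1 + t) = -f t / 2 := by field_simp
  linarith

/-- A causal operator that contracts an exponentially weighted norm has a fixed point. -/
theorem exists_fixedPoint_causal (N : (ℝ → ℝ) → ℝ → ℝ) {K B : ℝ}
    (hc : ∀ x, Continuous x → Continuous (N x))
    (h0 : ∀ t, 0 ≤ t → |N 0 t| ≤ B * Real.exp (K * t))
    (hL : ∀ x y D, Continuous x → Continuous y → 0 ≤ D →
      (∀ s, 0 ≤ s → |x s - y s| ≤ D * Real.exp (K * s)) →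
      ∀ t, 0 ≤ t → |N x t - N y t| ≤ D / 2 * Real.exp (K * t)) :
    ∃ x, Continuous x ∧ ∀ t, 0 ≤ t → x t = N x t := by
  let lift : BoundedContinuousFunction ℝ ℝ → ℝ → ℝ := fun u t => Real.exp (K * |t|) * u t
  have hlift : ∀ u, Continuous (lift u) := fun u => by
    have := u.continuous
    fun_prop
  have hdist : ∀ u v : BoundedContinuousFunction ℝ ℝ, ∀ s, 0 ≤ s →
      |lift u s - lift v s| ≤ dist u v * Real.exp (K * s) := by
    intro u v s hs
    simp only [lift, ← mul_sub, abs_mul, Real.abs_exp, abs_of_nonneg hs]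
    rw [mul_comm]
    gcongr
    exact BoundedContinuousFunction.dist_coe_le_dist (f := u) (g := v) s
  have hzero : lift 0 = 0 := by funext t; simp [lift]
  have hbd : ∀ u : BoundedContinuousFunction ℝ ℝ, ∀ t : ℝ,
      ‖Real.exp (-(K * |t|)) * N (lift u) |t|‖ ≤ B + dist u 0 / 2 := by
    intro u t
    have ht := abs_nonneg t
    generalize |t| = τ at ht ⊢
    have h1 := hL _ _ (dist u 0) (hlift u) (hlift 0) dist_nonneg (hdist u 0) τ ht
    have h2 := h0 τ ht
    rw [hzero] at h1
    have h3 : |N (lift u) τ| ≤ (B + dist u 0 / 2) * Real.exp (K * τ) := by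
      have := abs_add_le (N (lift u) τ - N 0 τ) (N 0 τ)
      rw [sub_add_cancel] at this
      linarith
    rw [Real.norm_eq_abs, abs_mul, Real.abs_exp, Real.exp_neg, inv_mul_le_iff₀ (Real.exp_pos _)]
    linarith
  let Φ : BoundedContinuousFunction ℝ ℝ → BoundedContinuousFunction ℝ ℝ := fun u =>
    BoundedContinuousFunction.ofNormedAddCommGroup
      (fun t => Real.exp (-(K * |t|)) * N (lift u) |t|)
      (by have := hc _ (hlift u); fun_prop) _ (hbd u)
  have hΦ : ContractingWith (1 / 2) Φ := by
    refine ⟨by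
      rw [← NNReal.coe_lt_coe]; norm_num, LipschitzWith.of_dist_le_mul fun u v => ?_⟩
    refine (BoundedContinuousFunction.dist_le (by positivity)).2 fun t => ?_
    simp only [Φ, BoundedContinuousFunction.coe_ofNormedAddCommGroup, Real.dist_eq, ← mul_sub,
      abs_mul, Real.abs_exp]
    have ht := abs_nonneg t
    generalize |t| = τ at ht ⊢
    have h1 := hL _ _ (dist u v) (hlift u) (hlift v) dist_nonneg (hdist u v) τ ht
    rw [Real.exp_neg, inv_mul_le_iff₀ (Real.exp_pos _)]
    push_cast
    linarith
  have hfix := hΦ.fixedPoint_isFixedPt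
  set u := ContractingWith.fixedPoint Φ hΦ
  refine ⟨lift u, hlift u, fun t ht => ?_⟩
  have : u t = Real.exp (-(K * |t|)) * N (lift u) |t| := by
    conv_lhs => rw [← hfix]
    rfl
  simp only [lift]
  rw [this, ← mul_assoc, ← Real.exp_add, abs_of_nonneg ht]
  simp [lift]

theorem abs_exp_neg_sub_le {a b : ℝ} (ha : 0 ≤ a) (hb : 0 ≤ b) :
    |Real.exp (-a) - Real.exp (-b)| ≤ |a - b| := by
  wlog h : a ≤ b generalizing a b
  · rw [abs_sub_comm, abs_sub_comm a]
    exact this hb ha (le_of_not_ge h)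
  rw [abs_of_nonneg (by simpa using h), abs_sub_comm, abs_of_nonneg (by linarith)]
  have h1 : Real.exp (-b) = Real.exp (-a) * Real.exp (-(b - a)) := by
    rw [← Real.exp_add]; ring_nf
  have h2 := Real.add_one_le_exp (-(b - a))
  have h3 : Real.exp (-a) ≤ 1 := by simpa using ha
  have h4 := Real.exp_pos (-a)
  rw [h1]
  nlinarith

theorem integral_exp_mul_le {K t : ℝ} (hK : 0 < K) :
    ∫ s in (0 : ℝ)..t, Real.exp (K * s) ≤ Real.exp (K * t) / K := by
  have : ∫ s in (0 : ℝ)..t, Real.exp (K * s) = (Real.exp (K * t) - 1) / K := by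
    rw [intervalIntegral.integral_comp_mul_left (fun s => Real.exp s) hK.ne', integral_exp]
    simp
    field_simp
  rw [this]
  gcongr
  linarith

/-- The probability that nothing has happened by time `t` when events come at rate
`lam * y`. -/
noncomputable def expInt (lam : ℝ) (y : ℝ → ℝ) (t : ℝ) : ℝ :=
  Real.exp (-(lam * ∫ s in (0 : ℝ)..t, y s))

theorem hasDerivAt_expInt {lam : ℝ} {y : ℝ → ℝ} (hy : Continuous y) (t : ℝ) :
    HasDerivAt (expInt lam y) (-(lam * y t) * expInt lam y t) t := by
  have h1 : HasDerivAt (fun t => ∫ s in (0 : ℝ)..t, y s) (y t) t :=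
    (hy.integral_hasStrictDerivAt 0 t).hasDerivAt
  have := (h1.const_mul lam).neg.exp
  rw [mul_comm]
  exact this

theorem continuous_expInt {lam : ℝ} {y : ℝ → ℝ} (hy : Continuous y) :
    Continuous (expInt lam y) :=
  continuous_iff_continuousAt.2 fun t => (hasDerivAt_expInt hy t).continuousAt

theorem expInt_zero (lam : ℝ) (y : ℝ → ℝ) : expInt lam y 0 = 1 := by simp [expInt]

theorem expInt_pos (lam : ℝ) (y : ℝ → ℝ) (t : ℝ) : 0 < expInt lam y t := Real.exp_pos _

theorem integral_nonneg_of_nonneg {y : ℝ → ℝ} (h : ∀ t, 0 ≤ y t) {t : ℝ} (ht : 0 ≤ t) :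
    0 ≤ ∫ s in (0 : ℝ)..t, y s := intervalIntegral.integral_nonneg ht fun s _ => h s

theorem expInt_le_one {lam : ℝ} (hlam : 0 ≤ lam) {y : ℝ → ℝ} (h : ∀ t, 0 ≤ y t) {t : ℝ}
    (ht : 0 ≤ t) : expInt lam y t ≤ 1 := by
  have := mul_nonneg hlam (integral_nonneg_of_nonneg h ht)
  simpa [expInt] using this

theorem abs_expInt_sub_le {lam K D t : ℝ} (hlam : 0 ≤ lam) (hK : 0 < K) {y z : ℝ → ℝ}
    (hyc : Continuous y) (hzc : Continuous z) (hy : ∀ t, 0 ≤ y t) (hz : ∀ t, 0 ≤ z t)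
    (hD : 0 ≤ D) (h : ∀ s, 0 ≤ s → |y s - z s| ≤ D * Real.exp (K * s)) (ht : 0 ≤ t) :
    |expInt lam y t - expInt lam z t| ≤ lam * D / K * Real.exp (K * t) := by
  refine (abs_exp_neg_sub_le (mul_nonneg hlam (integral_nonneg_of_nonneg hy ht))
    (mul_nonneg hlam (integral_nonneg_of_nonneg hz ht))).trans ?_
  rw [← mul_sub, abs_mul, abs_of_nonneg hlam, ← intervalIntegral.integral_sub
    (hyc.intervalIntegrable _ _) (hzc.intervalIntegrable _ _)]
  have h1 : |∫ s in (0 : ℝ)..t, (y s - z s)| ≤ ∫ s in (0 : ℝ)..t, D * Real.exp (K * s) := by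
    rw [← Real.norm_eq_abs]
    refine intervalIntegral.norm_integral_le_of_norm_le ht ?_
      ((by fun_prop : Continuous fun s => D * Real.exp (K * s)).intervalIntegrable _ _)
    exact Eventually.of_forall fun s hs => h s hs.1.le
  rw [intervalIntegral.integral_const_mul] at h1
  calc lam * |∫ s in (0 : ℝ)..t, (y s - z s)| ≤ lam * (D * (Real.exp (K * t) / K)) := by
        gcongr
        exact h1.trans (by gcongr; exact integral_exp_mul_le hK)
    _ = _ := by ring

/-- The convolution is a contraction in both arguments for exponential weights. -/
theorem abs_halfConv_sub_le {K D E t : ℝ} (hK : 0 < K) {y z U W : ℝ → ℝ}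
    (hyc : Continuous y) (hzc : Continuous z) (hUc : Continuous U) (hWc : Continuous W)
    (hy : ∀ s, 0 ≤ s → |y s| * E ≤ E) (hE : 0 ≤ E) (hD : 0 ≤ D)
    (hW : ∀ s, 0 ≤ s → |W s| ≤ 1)
    (h : ∀ s, 0 ≤ s → |y s - z s| ≤ D * Real.exp (K * s))
    (h' : ∀ s, 0 ≤ s → |U s - W s| ≤ E * Real.exp (K * s)) (ht : 0 ≤ t) :
    |halfConv y U t - halfConv z W t| ≤ (D + E) / K * Real.exp (K * t) := by
  have e : halfConv y U t - halfConv z W t =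
      (∫ s in (0 : ℝ)..t, (y s - z s) * W (t - s)) +
        ∫ s in (0 : ℝ)..t, y (t - s) * (U s - W s) := by
    have e2 : (∫ s in (0 : ℝ)..t, y (t - s) * (U s - W s)) =
        ∫ s in (0 : ℝ)..t, y s * (U (t - s) - W (t - s)) := by
      have := intervalIntegral.integral_comp_sub_left
        (fun s => y s * (U (t - s) - W (t - s))) (a := 0) (b := t) t
      simpa using this
    rw [e2, halfConv, halfConv, ← intervalIntegral.integral_sub,
      ← intervalIntegral.integral_add]
    · congr 1; funext s; ring
    all_goals exact (by fun_prop : Continuous _).intervalIntegrable _ _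
  have b1 : |∫ s in (0 : ℝ)..t, (y s - z s) * W (t - s)| ≤
      ∫ s in (0 : ℝ)..t, D * Real.exp (K * s) := by
    rw [← Real.norm_eq_abs]
    refine intervalIntegral.norm_integral_le_of_norm_le ht ?_
      ((by fun_prop : Continuous fun s => D * Real.exp (K * s)).intervalIntegrable _ _)
    refine Eventually.of_forall fun s hs => ?_
    rw [Real.norm_eq_abs, abs_mul]
    have := hW (t - s) (by linarith [hs.2])
    have h2 := h s hs.1.le
    calc _ ≤ |y s - z s| * 1 := by gcongr
      _ ≤ _ := by linarith
  have b2 : |∫ s in (0 : ℝ)..t, y (t - s) * (U s - W s)| ≤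
      ∫ s in (0 : ℝ)..t, E * Real.exp (K * s) := by
    rw [← Real.norm_eq_abs]
    refine intervalIntegral.norm_integral_le_of_norm_le ht ?_
      ((by fun_prop : Continuous fun s => E * Real.exp (K * s)).intervalIntegrable _ _)
    refine Eventually.of_forall fun s hs => ?_
    rw [Real.norm_eq_abs, abs_mul]
    have := hy (t - s) (by linarith [hs.2])
    have h2 := h' s hs.1.le
    have h3 := Real.exp_pos (K * s)
    calc _ ≤ |y (t - s)| * (E * Real.exp (K * s)) := by gcongr
      _ = (|y (t - s)| * E) * Real.exp (K * s) := by ring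
      _ ≤ _ := by gcongr
  rw [intervalIntegral.integral_const_mul] at b1 b2
  have b3 := integral_exp_mul_le (t := t) hK
  rw [e]
  calc _ ≤ _ := abs_add_le _ _
    _ ≤ D * (Real.exp (K * t) / K) + E * (Real.exp (K * t) / K) := by
      refine add_le_add (b1.trans ?_) (b2.trans ?_) <;> gcongr
    _ = _ := by ring

/-- The survival function of a vertex: the nonlinear Volterra equation that it solves. -/
theorem exists_survival {lam mu : ℝ} (hlam : 0 < lam) (hmu : 0 < mu) :
    ∃ y : ℝ → ℝ, Continuous y ∧ (∀ t, 0 ≤ y t) ∧ (∀ t, 0 ≤ t → 0 < y t) ∧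
      ∀ t, 0 ≤ t → y t = 1 - mu * halfConv y (expInt lam y) t := by
  let c : ℝ → ℝ := fun x => max 0 (min 1 x)
  have hcc : Continuous c := by fun_prop
  have hc0 : ∀ x, 0 ≤ c x := fun x => le_max_left _ _
  have hc1 : ∀ x, c x ≤ 1 := fun x => max_le zero_le_one (min_le_left _ _)
  have hcl : ∀ x y, |c x - c y| ≤ |x - y| := fun x y => by
    refine (abs_max_sub_max_le_max _ _ _ _).trans ?_
    simp only [sub_self, abs_zero]
    refine max_le (abs_nonneg _) ((abs_min_sub_min_le_max _ _ _ _).trans ?_)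
    simp
  let N : (ℝ → ℝ) → ℝ → ℝ := fun x t =>
    1 - mu * halfConv (fun s => c (x s)) (expInt lam fun s => c (x s)) t
  have hNc : ∀ x, Continuous x → Continuous (N x) := fun x hx => by
    have h1 : Continuous fun s => c (x s) := hcc.comp hx
    have := continuous_halfConv h1 (continuous_expInt (lam := lam) h1)
    fun_prop
  set K : ℝ := 4 * (lam + mu) with hKdef
  have hK : 0 < K := by positivity
  obtain ⟨x, hx, hfix⟩ := exists_fixedPoint_causal N (K := K) (B := 1) hNc (by
      intro t ht
      have : N 0 t = 1 := by simp [N, halfConv, c]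
      rw [this, abs_one, one_mul]
      exact Real.one_le_exp (by positivity)) (by
      intro x y D hx hy hD h t ht
      have hx' : Continuous fun s => c (x s) := hcc.comp hx
      have hy' : Continuous fun s => c (y s) := hcc.comp hy
      have hD' : 0 ≤ lam * D / K := by positivity
      have h1 : ∀ s, 0 ≤ s → |c (x s) - c (y s)| ≤ D * Real.exp (K * s) :=
        fun s hs => (hcl _ _).trans (h s hs)
      have := abs_halfConv_sub_le hK hx' hy' (continuous_expInt (lam := lam) hx')
        (continuous_expInt (lam := lam) hy')
        (fun s _ => by rw [abs_of_nonneg (hc0 _)]; nlinarith [hc1 (x s)]) hD' hD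
        (fun s hs => by
          rw [abs_of_pos (expInt_pos _ _ _)]
          exact expInt_le_one hlam.le (fun s => hc0 _) hs) h1
        (fun s hs => abs_expInt_sub_le hlam.le hK hx' hy' (fun s => hc0 _) (fun s => hc0 _) hD h1
          hs) ht
      have e : N x t - N y t = -(mu * (halfConv (fun s => c (x s)) (expInt lam fun s => c (x s)) t
        - halfConv (fun s => c (y s)) (expInt lam fun s => c (y s)) t)) := by
        simp only [N]; ring
      rw [e, abs_neg, abs_mul, abs_of_pos hmu]
      have hmuK : mu / K ≤ 1 / 4 := by
        rw [div_le_iff₀ hK]; linarith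
      have hlamK : lam / K ≤ 1 := by
        rw [div_le_iff₀ hK]; linarith
      calc _ ≤ mu * ((D + lam * D / K) / K * Real.exp (K * t)) := by gcongr
        _ = (mu / K) * (D + lam / K * D) * Real.exp (K * t) := by ring
        _ ≤ (1 / 4) * (D + 1 * D) * Real.exp (K * t) := by gcongr
        _ = _ := by ring)
  set y : ℝ → ℝ := fun t => c (x t) with hy
  have hyc : Continuous y := hcc.comp hx
  have hy0 : ∀ t, 0 ≤ y t := fun t => hc0 _
  set F : ℝ → ℝ := fun t => 1 - mu * halfConv y (expInt lam y) t with hF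
  have hac := continuous_expInt (lam := lam) hyc
  have hFd : ∀ t, HasDerivAt F
      (-(mu * (y t + halfConv y (fun t => -(lam * y t) * expInt lam y t) t))) t := fun t => by
    have := ((hasDerivAt_halfConv hyc (by fun_prop) (fun t => hasDerivAt_expInt (lam := lam) hyc t)
      t).const_mul mu).const_sub 1
    simpa [expInt_zero] using this
  have hconv : ∀ t, 0 ≤ t → halfConv y (fun t => -(lam * y t) * expInt lam y t) t ≤ 0 := by
    intro t ht
    have := halfConv_nonneg (y := y) (U := fun t => (lam * y t) * expInt lam y t) ht
      (fun s _ => hy0 s)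
      (fun s _ => mul_nonneg (mul_nonneg hlam.le (hy0 s)) (expInt_pos _ _ _).le)
    have e : halfConv y (fun t => -(lam * y t) * expInt lam y t) t =
        -halfConv y (fun t => (lam * y t) * expInt lam y t) t := by
      simp only [halfConv, ← intervalIntegral.integral_neg]
      congr 1; funext s; ring
    linarith
  have hFx : ∀ t, 0 ≤ t → F t = x t := fun t ht => (hfix t ht).symm
  have hFnonneg : ∀ t, 0 ≤ t → 0 ≤ F t := by
    intro t ht
    refine nonneg_of_deriv_nonneg_of_neg hFd (by simp [hF, halfConv]) ?_ ht
    intro s hs hneg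
    have hys : y s = 0 := by
      rw [hFx s hs] at hneg
      exact max_eq_left ((min_le_right _ _).trans hneg.le)
    rw [hys, zero_add]
    nlinarith [hconv s hs]
  have hFle : ∀ t, 0 ≤ t → F t ≤ 1 := fun t ht => by
    have := halfConv_nonneg ht (fun s _ => hy0 s) (fun s _ => (expInt_pos lam y s).le)
    simp only [hF]
    nlinarith
  have hyF : ∀ t, 0 ≤ t → y t = F t := fun t ht => by
    have h1 := hFnonneg t ht
    have h2 := hFle t ht
    rw [hFx t ht] at h1 h2
    rw [hFx t ht]
    simp [hy, c, h1, h2]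
  refine ⟨y, hyc, hy0, fun t ht => ?_, hyF⟩
  have hmono : MonotoneOn (fun t => Real.exp (mu * t) * F t) (Ici 0) := by
    have hd : ∀ t, HasDerivAt (fun t => Real.exp (mu * t) * F t)
        (Real.exp (mu * t) * (mu * 1) * F t + Real.exp (mu * t) *
          (-(mu * (y t + halfConv y (fun t => -(lam * y t) * expInt lam y t) t)))) t := fun t =>
      ((hasDerivAt_id t).const_mul mu).exp.mul (hFd t)
    refine monotoneOn_of_deriv_nonneg (convex_Ici 0)
      (fun t _ => (hd t).continuousAt.continuousWithinAt)
      (fun t _ => (hd t).differentiableAt.differentiableWithinAt) fun t ht => ?_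
    rw [interior_Ici] at ht
    rw [(hd t).deriv, hyF t (le_of_lt ht)]
    have h1 := hconv t (le_of_lt ht)
    have h2 : 0 ≤ Real.exp (mu * t) * (mu * -halfConv y (fun t => -(lam * y t) * expInt lam y t) t) := by
      have := Real.exp_pos (mu * t)
      have : 0 ≤ -halfConv y (fun t => -(lam * y t) * expInt lam y t) t := by linarith
      positivity
    linarith
  have := hmono (mem_Ici.2 le_rfl) (mem_Ici.2 ht) ht
  simp only [mul_zero, Real.exp_zero, one_mul] at this
  have hF0 : F 0 = 1 := by simp [hF, halfConv]
  rw [hF0] at this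
  rw [hyF t ht]
  exact pos_of_mul_pos_right (lt_of_lt_of_le one_pos this) (Real.exp_pos _).le

/-- The renewal equation with a smooth increasing inhomogeneity. -/
theorem exists_renewal {lam mu : ℝ} (hlam : 0 < lam) (hmu : 0 < mu) {y₀ y : ℝ → ℝ}
    (hy₀c : Continuous y₀) (hy₀ : ∀ t, 0 ≤ y₀ t) (hyc : Continuous y) (hy : ∀ t, 0 ≤ y t) :
    ∃ z : ℝ → ℝ, Continuous z ∧ (∀ t, 0 ≤ z t) ∧
      ∀ t, 0 ≤ t → z t = 1 - expInt lam y t - mu * halfConv z (expInt lam y₀) t := by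
  let c : ℝ → ℝ := fun x => max 0 x
  have hcc : Continuous c := by fun_prop
  have hc0 : ∀ x, 0 ≤ c x := fun x => le_max_left _ _
  have hcl : ∀ x y, |c x - c y| ≤ |x - y| := fun x y => by
    refine (abs_max_sub_max_le_max _ _ _ _).trans ?_
    simp
  have hac := continuous_expInt (lam := lam) hyc
  have hac₀ := continuous_expInt (lam := lam) hy₀c
  let N : (ℝ → ℝ) → ℝ → ℝ := fun x t =>
    1 - expInt lam y t - mu * halfConv (fun s => c (x s)) (expInt lam y₀) t
  have hNc : ∀ x, Continuous x → Continuous (N x) := fun x hx => by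
    have h1 : Continuous fun s => c (x s) := hcc.comp hx
    have := continuous_halfConv h1 hac₀
    fun_prop
  set K : ℝ := 2 * mu with hKdef
  have hK : 0 < K := by positivity
  obtain ⟨x, hx, hfix⟩ := exists_fixedPoint_causal N (K := K) (B := 1) hNc (by
      intro t ht
      have : N 0 t = 1 - expInt lam y t := by simp [N, halfConv, c]
      have h1 := expInt_le_one hlam.le hy ht
      have h2 := expInt_pos lam y t
      rw [this, abs_of_nonneg (by linarith), one_mul]
      have : 1 ≤ Real.exp (K * t) := Real.one_le_exp (by positivity)
      linarith) (by
      intro x y D hx hy hD h t ht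
      have hx' : Continuous fun s => c (x s) := hcc.comp hx
      have hy' : Continuous fun s => c (y s) := hcc.comp hy
      have := abs_halfConv_sub_le (E := 0) hK hx' hy' hac₀ hac₀ (by simp) le_rfl hD
        (fun s hs => by
          rw [abs_of_pos (expInt_pos _ _ _)]
          exact expInt_le_one hlam.le hy₀ hs) (fun s hs => (hcl _ _).trans (h s hs))
        (by simp) ht
      have e : N x t - N y t = -(mu * (halfConv (fun s => c (x s)) (expInt lam y₀) t
        - halfConv (fun s => c (y s)) (expInt lam y₀) t)) := by
        simp only [N]; ring
      rw [e, abs_neg, abs_mul, abs_of_pos hmu]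
      calc _ ≤ mu * ((D + 0) / K * Real.exp (K * t)) := by gcongr
        _ = _ := by rw [hKdef]; field_simp; ring)
  set z : ℝ → ℝ := fun t => c (x t) with hz
  have hzc : Continuous z := hcc.comp hx
  have hz0 : ∀ t, 0 ≤ z t := fun t => hc0 _
  set F : ℝ → ℝ := fun t => 1 - expInt lam y t - mu * halfConv z (expInt lam y₀) t with hF
  have hFd : ∀ t, HasDerivAt F (lam * y t * expInt lam y t -
      mu * (z t + halfConv z (fun t => -(lam * y₀ t) * expInt lam y₀ t) t)) t := fun t => by
    have := ((hasDerivAt_expInt (lam := lam) hyc t).const_sub 1).sub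
      ((hasDerivAt_halfConv hzc (by fun_prop) (fun t => hasDerivAt_expInt (lam := lam) hy₀c t)
      t).const_mul mu)
    refine this.congr_deriv ?_
    simp [expInt_zero]
  have hconv : ∀ t, 0 ≤ t → halfConv z (fun t => -(lam * y₀ t) * expInt lam y₀ t) t ≤ 0 := by
    intro t ht
    have := halfConv_nonneg (y := z) (U := fun t => (lam * y₀ t) * expInt lam y₀ t) ht
      (fun s _ => hz0 s)
      (fun s _ => mul_nonneg (mul_nonneg hlam.le (hy₀ s)) (expInt_pos _ _ _).le)
    have e : halfConv z (fun t => -(lam * y₀ t) * expInt lam y₀ t) t =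
        -halfConv z (fun t => (lam * y₀ t) * expInt lam y₀ t) t := by
      simp only [halfConv, ← intervalIntegral.integral_neg]
      congr 1; funext s; ring
    linarith
  have hFx : ∀ t, 0 ≤ t → F t = x t := fun t ht => (hfix t ht).symm
  have hFnonneg : ∀ t, 0 ≤ t → 0 ≤ F t := by
    intro t ht
    refine nonneg_of_deriv_nonneg_of_neg hFd (by simp [hF, halfConv, expInt_zero]) ?_ ht
    intro s hs hneg
    have hys : z s = 0 := by
      rw [hFx s hs] at hneg
      exact max_eq_left hneg.le
    rw [hys, zero_add]
    have := mul_nonneg (mul_nonneg hlam.le (hy s)) (expInt_pos lam y s).le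
    nlinarith [hconv s hs]
  refine ⟨z, hzc, hz0, fun t ht => ?_⟩
  have h1 := hFnonneg t ht
  have h2 : z t = F t := by
    rw [hFx t ht] at h1 ⊢
    exact max_eq_right h1
  exact h2

end Volterra

section Rates

/-- `y n t` is the probability that the progeny of a vertex reaches, at age `t` and without having
died out, a height of at least `n`: the renewal equations that these functions solve. -/
structure IsRates (lam mu : ℝ) (y : ℕ → ℝ → ℝ) : Prop where
  continuous : ∀ n, Continuous (y n)
  nonneg : ∀ n t, 0 ≤ y n t
  pos : ∀ t, 0 ≤ t → 0 < y 0 t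
  eq_zero : ∀ t, 0 ≤ t → y 0 t = 1 - mu * halfConv (y 0) (expInt lam (y 0)) t
  eq_succ : ∀ n t, 0 ≤ t →
    y (n + 1) t = 1 - expInt lam (y n) t - mu * halfConv (y (n + 1)) (expInt lam (y 0)) t

theorem exists_isRates {lam mu : ℝ} (hlam : 0 < lam) (hmu : 0 < mu) :
    ∃ y, IsRates lam mu y := by
  obtain ⟨y₀, hc, h0, hpos, heq⟩ := exists_survival hlam hmu
  choose step hstep using fun z : {z : ℝ → ℝ // Continuous z ∧ ∀ t, 0 ≤ z t} =>
    exists_renewal hlam hmu hc h0 z.2.1 z.2.2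
  let Y : ℕ → {z : ℝ → ℝ // Continuous z ∧ ∀ t, 0 ≤ z t} := fun n =>
    Nat.rec ⟨y₀, hc, h0⟩ (fun _ z => ⟨step z, (hstep z).1, (hstep z).2.1⟩) n
  exact ⟨fun n => (Y n).1, fun n => (Y n).2.1, fun n => (Y n).2.2, hpos, heq,
    fun n => (hstep (Y n)).2.2⟩

theorem monotone_integral_of_nonneg {y : ℝ → ℝ} (hc : Continuous y) (h : ∀ t, 0 ≤ y t) :
    Monotone fun t => ∫ s in (0 : ℝ)..t, y s := by
  intro a b hab
  have := intervalIntegral.integral_interval_sub_left (μ := volume)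
    (hc.intervalIntegrable 0 b) (hc.intervalIntegrable 0 a)
  have h2 : 0 ≤ ∫ s in a..b, y s := intervalIntegral.integral_nonneg hab fun s _ => h s
  simp only
  linarith

theorem antitone_expInt {lam : ℝ} (hlam : 0 ≤ lam) {y : ℝ → ℝ} (hc : Continuous y)
    (h : ∀ t, 0 ≤ y t) : Antitone (expInt lam y) := by
  intro a b hab
  have := monotone_integral_of_nonneg hc h hab
  simp only [expInt]
  gcongr

theorem integral_mul_le_halfConv {y a : ℝ → ℝ} (hyc : Continuous y) (hac : Continuous a)
    (hy : ∀ t, 0 ≤ y t) {t c : ℝ} (ht : 0 ≤ t) (hc : ∀ s, 0 ≤ s → s ≤ t → c ≤ a s) :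
    (∫ s in (0 : ℝ)..t, y s) * c ≤ halfConv y a t := by
  rw [← intervalIntegral.integral_mul_const]
  refine intervalIntegral.integral_mono_on ht
    ((by fun_prop : Continuous fun s => y s * c).intervalIntegrable _ _)
    ((by fun_prop : Continuous fun s => y s * a (t - s)).intervalIntegrable _ _) fun s hs => ?_
  exact mul_le_mul_of_nonneg_left (hc _ (by linarith [hs.2]) (by linarith [hs.1])) (hy s)

theorem tendsto_halfConv {y a : ℝ → ℝ} (hyc : Continuous y) (hac : Continuous a)
    (hy : ∀ t, 0 ≤ y t) (ha : Antitone a) (ha1 : ∀ t, 0 ≤ t → a t ≤ 1) {I A : ℝ}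
    (hI : Tendsto (fun t => ∫ s in (0 : ℝ)..t, y s) atTop (𝓝 I)) (hA : Tendsto a atTop (𝓝 A)) :
    Tendsto (halfConv y a) atTop (𝓝 (I * A)) := by
  have hhalf : Tendsto (fun t : ℝ => t / 2) atTop atTop := tendsto_id.atTop_div_const two_pos
  have hup : Tendsto (fun t => (∫ s in (0 : ℝ)..(t / 2), y s) * a (t / 2) +
      ((∫ s in (0 : ℝ)..t, y s) - ∫ s in (0 : ℝ)..(t / 2), y s)) atTop (𝓝 (I * A + (I - I))) :=
    ((hI.comp hhalf).mul (hA.comp hhalf)).add (hI.sub (hI.comp hhalf))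
  rw [sub_self, add_zero] at hup
  refine tendsto_of_tendsto_of_tendsto_of_le_of_le' (hI.mul_const A) hup ?_ ?_
  · filter_upwards [eventually_ge_atTop 0] with t ht
    exact integral_mul_le_halfConv hyc hac hy ht fun s _ _ => ha.le_of_tendsto hA s
  · filter_upwards [eventually_ge_atTop 0] with t ht
    have hi : ∀ p q, IntervalIntegrable (fun s => y s * a (t - s)) volume p q := fun p q =>
      (by fun_prop : Continuous fun s => y s * a (t - s)).intervalIntegrable _ _
    rw [halfConv, ← intervalIntegral.integral_add_adjacent_intervals (hi 0 (t / 2)) (hi (t / 2) t)]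
    rw [intervalIntegral.integral_interval_sub_left (hyc.intervalIntegrable _ _)
      (hyc.intervalIntegrable _ _), ← intervalIntegral.integral_mul_const]
    refine add_le_add (intervalIntegral.integral_mono_on (by linarith) (hi _ _)
      ((by fun_prop : Continuous fun s => y s * a (t / 2)).intervalIntegrable _ _) fun s hs => ?_)
      (intervalIntegral.integral_mono_on (by linarith) (hi _ _) (hyc.intervalIntegrable _ _)
        fun s hs => ?_)
    · exact mul_le_mul_of_nonneg_left (ha (by linarith [hs.2])) (hy s)
    · exact mul_le_of_le_one_right (hy s) (ha1 _ (by linarith [hs.2]))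

theorem limit_nonpos_of_integral_le {f : ℝ → ℝ} (hf : Continuous f) {L B : ℝ}
    (hL : Tendsto f atTop (𝓝 L)) (hB : ∀ t, 0 ≤ t → ∫ s in (0 : ℝ)..t, f s ≤ B) : L ≤ 0 := by
  by_contra! hpos
  obtain ⟨t₀, ht₀⟩ := eventually_atTop.1 (hL.eventually (lt_mem_nhds (half_lt_self hpos)))
  set a := max t₀ 0 with ha
  set C := ∫ s in (0 : ℝ)..a, f s with hC
  have key : ∀ d, 0 ≤ d → C + d * (L / 2) ≤ B := by
    intro d hd
    have h1 := hB (a + d) (by positivity)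
    rw [← intervalIntegral.integral_add_adjacent_intervals (hf.intervalIntegrable 0 a)
      (hf.intervalIntegrable a (a + d))] at h1
    have h2 : ∫ s in a..(a + d), L / 2 ≤ ∫ s in a..(a + d), f s :=
      intervalIntegral.integral_mono_on (by linarith) (by simp) (hf.intervalIntegrable _ _)
        fun s hs => (ht₀ s ((le_max_left _ _).trans hs.1)).le
    simp only [intervalIntegral.integral_const, add_sub_cancel_left, smul_eq_mul] at h2
    linarith
  have h3 := key ((|B - C| + 1) / (L / 2)) (by positivity)
  rw [div_mul_cancel₀ _ (by positivity)] at h3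
  linarith [le_abs_self (B - C)]

/-- The limit of the mass of the solution of a renewal equation. -/
theorem tendsto_integral_of_renewal {mu A g : ℝ} (hmu : 0 < mu) (hA : 0 < A) {y a G : ℝ → ℝ}
    (hyc : Continuous y) (hac : Continuous a) (hy : ∀ t, 0 ≤ y t) (ha : Antitone a)
    (ha1 : ∀ t, 0 ≤ t → a t ≤ 1) (hlim : Tendsto a atTop (𝓝 A)) (hG : Tendsto G atTop (𝓝 g))
    (hG1 : ∀ t, 0 ≤ t → G t ≤ 1) (heq : ∀ t, 0 ≤ t → y t = G t - mu * halfConv y a t) :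
    Tendsto (fun t => ∫ s in (0 : ℝ)..t, y s) atTop (𝓝 (g / (mu * A))) := by
  have hbd : ∀ t, 0 ≤ t → ∫ s in (0 : ℝ)..t, y s ≤ 1 / (mu * A) := by
    intro t ht
    have h1 := integral_mul_le_halfConv hyc hac hy ht fun s _ _ => ha.le_of_tendsto hlim s
    have h2 := heq t ht
    have h3 := hG1 t ht
    have h4 := hy t
    rw [le_div_iff₀ (by positivity)]
    nlinarith
  have hmono := monotone_integral_of_nonneg hyc hy
  have hbdd : BddAbove (range fun t => ∫ s in (0 : ℝ)..t, y s) := by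
    refine ⟨1 / (mu * A), ?_⟩
    rintro _ ⟨t, rfl⟩
    exact (hmono (le_max_left t 0)).trans (hbd _ (le_max_right _ _))
  have hI := tendsto_atTop_ciSup hmono hbdd
  set I := ⨆ t, ∫ s in (0 : ℝ)..t, y s
  have hylim : Tendsto y atTop (𝓝 (g - mu * (I * A))) := by
    refine (hG.sub ((tendsto_halfConv hyc hac hy ha ha1 hI hlim).const_mul mu)).congr' ?_
    filter_upwards [eventually_ge_atTop 0] with t ht
    exact (heq t ht).symm
  have h1 := limit_nonpos_of_integral_le hyc hylim hbd
  have h2 : 0 ≤ g - mu * (I * A) := ge_of_tendsto' hylim hy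
  have : I = g / (mu * A) := by
    rw [eq_div_iff (by positivity)]
    linarith
  rwa [← this]

namespace IsRates

variable {lam mu : ℝ} {y : ℕ → ℝ → ℝ}

theorem tendsto_expInt_zero (h : IsRates lam mu y) (hlam : 0 < lam) (hmu : 0 < mu) {r : ℝ}
    (hr0 : 0 < r) (hr : IsLeast {x : ℝ | x * Real.exp (-x) = lam / mu} r) :
    Tendsto (expInt lam (y 0)) atTop (𝓝 (Real.exp (-r))) := by
  have hc := h.continuous 0
  have hac := continuous_expInt (lam := lam) hc
  have hanti := antitone_expInt hlam.le hc (h.nonneg 0)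
  set X : ℝ → ℝ := fun t => ∫ s in (0 : ℝ)..t, y 0 s with hX
  have hXc : Continuous X := intervalIntegral.continuous_primitive
    (fun a b => hc.intervalIntegrable a b) 0
  have hlt : ∀ t, 0 ≤ t → lam * X t < r := by
    intro t ht
    by_contra! hge
    obtain ⟨s, hs, hsr⟩ := intermediate_value_Icc (f := fun t => lam * X t) ht
      (by fun_prop) (show r ∈ Icc _ _ from ⟨by simp [hX, hr0.le], hge⟩)
    simp only at hsr
    have h1 := integral_mul_le_halfConv hc hac (h.nonneg 0) hs.1 (c := expInt lam (y 0) s)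
      fun u _ hu => hanti hu
    have h2 := h.eq_zero s hs.1
    have h3 := h.pos s hs.1
    have h4 : r * Real.exp (-r) = lam / mu := hr.1
    have h5 : expInt lam (y 0) s = Real.exp (-r) := by rw [← hsr]; rfl
    rw [h5] at h1
    rw [eq_div_iff hmu.ne'] at h4
    have h6 : mu * (X s * Real.exp (-r)) < 1 := by nlinarith
    have h7 := mul_lt_mul_of_pos_left h6 hlam
    have h8 : lam * (mu * (X s * Real.exp (-r))) = lam * X s * Real.exp (-r) * mu := by ring
    rw [h8, hsr, h4] at h7
    linarith
  have hge : ∀ t, Real.exp (-r) ≤ expInt lam (y 0) t := by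
    intro t
    refine le_trans ?_ (hanti (le_max_left t 0))
    simp only [expInt]
    gcongr
    exact (hlt _ (le_max_right _ _)).le
  have hlim := tendsto_atTop_ciInf hanti ⟨_, by rintro _ ⟨t, rfl⟩; exact hge t⟩
  set A := ⨅ t, expInt lam (y 0) t
  have hA : Real.exp (-r) ≤ A := le_ciInf hge
  have hA0 : 0 < A := (Real.exp_pos _).trans_le hA
  have hI := tendsto_integral_of_renewal hmu hA0 hc hac (h.nonneg 0) hanti
    (fun t ht => expInt_le_one hlam.le (h.nonneg 0) ht) hlim (tendsto_const_nhds (x := 1))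
    (fun _ _ => le_rfl) (h.eq_zero)
  have hA' : A = Real.exp (-(lam * (1 / (mu * A)))) :=
    tendsto_nhds_unique hlim ((hI.const_mul lam).neg.rexp)
  have hle : lam * (1 / (mu * A)) ≤ r := by
    refine le_of_tendsto (hI.const_mul lam) ?_
    filter_upwards [eventually_ge_atTop 0] with t ht
    exact (hlt t ht).le
  have hge' : r ≤ lam * (1 / (mu * A)) := by
    refine hr.2 ?_
    change _ * _ = _
    rw [← hA']
    field_simp
  rw [le_antisymm hge' hle, ← hA']
  exact hlim

theorem tendsto_expInt_succ (h : IsRates lam mu y) (hlam : 0 < lam) (hmu : 0 < mu) {r : ℝ}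
    (hr0 : 0 < r) (hr : IsLeast {x : ℝ | x * Real.exp (-x) = lam / mu} r) {n : ℕ} {L : ℝ}
    (hL : Tendsto (expInt lam (y n)) atTop (𝓝 L)) :
    Tendsto (expInt lam (y (n + 1))) atTop (𝓝 (Real.exp (-(r * (1 - L))))) := by
  have hac := continuous_expInt (lam := lam) (h.continuous 0)
  have hI := tendsto_integral_of_renewal hmu (Real.exp_pos (-r)) (h.continuous (n + 1)) hac
    (h.nonneg _) (antitone_expInt hlam.le (h.continuous 0) (h.nonneg 0))
    (fun t ht => expInt_le_one hlam.le (h.nonneg 0) ht) (h.tendsto_expInt_zero hlam hmu hr0 hr)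
    (hL.const_sub 1) (fun t _ => by linarith [expInt_pos lam (y n) t]) (h.eq_succ n)
  have e : lam * ((1 - L) / (mu * Real.exp (-r))) = r * (1 - L) := by
    have h4 : r * Real.exp (-r) = lam / mu := hr.1
    have : lam = r * Real.exp (-r) * mu := by rw [h4]; field_simp
    have hpos := Real.exp_pos (-r)
    rw [this]
    field_simp
  rw [← e]
  exact (hI.const_mul lam).neg.rexp

end IsRates

end Rates

namespace RTree

mutual

/-- `psi lam mu y T 0 t` is the probability that the progeny `T` of a vertex has died out by time
`t`, and `psi lam mu y T (n + 1) t` is the probability that it has died out or its height at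
time `t` is at most `n`. -/
noncomputable def psi (lam mu : ℝ) (y : ℕ → ℝ → ℝ) : RTree → ℕ → ℝ → ℝ
  | node l, 0, t =>
      mu * halfConv (y 0) (fun s => expInt lam (y 0) s * psiForest lam mu y l 0 s) t
  | node l, n + 1, t => expInt lam (y n) t * psiForest lam mu y l n t +
      mu * halfConv (y (n + 1)) (fun s => expInt lam (y 0) s * psiForest lam mu y l 0 s) t

/-- The product of `psi` over a list of trees. -/
noncomputable def psiForest (lam mu : ℝ) (y : ℕ → ℝ → ℝ) : List RTree → ℕ → ℝ → ℝ
  | [], _, _ => 1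
  | c :: l, n, t => psi lam mu y c n t * psiForest lam mu y l n t

end

/-- The probability that a tree that starts from `T` has height at most `n` at time `t`. -/
noncomputable def heightProb (lam mu : ℝ) (y : ℕ → ℝ → ℝ) : RTree → ℕ → ℝ → ℝ
  | node l, n, t => expInt lam (y n) t * psiForest lam mu y l n t

variable {lam mu : ℝ} {y : ℕ → ℝ → ℝ}

theorem psi_zero (T : RTree) (t : ℝ) : psi lam mu y T 0 t =
    mu * halfConv (y 0) (heightProb lam mu y T 0) t := by
  rcases T with ⟨l⟩
  simp only [psi]
  rfl

theorem psi_succ (T : RTree) (n : ℕ) (t : ℝ) : psi lam mu y T (n + 1) t =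
    heightProb lam mu y T n t +
      mu * halfConv (y (n + 1)) (heightProb lam mu y T 0) t := by
  rcases T with ⟨l⟩
  simp only [psi]
  rfl

theorem heightProb_single (n : ℕ) (t : ℝ) :
    heightProb lam mu y single n t = expInt lam (y n) t := by
  simp [heightProb, single, psiForest]

theorem psi_single (h : IsRates lam mu y) (n : ℕ) {t : ℝ} (ht : 0 ≤ t) :
    psi lam mu y single n t = 1 - y n t := by
  have e : heightProb lam mu y single 0 = expInt lam (y 0) := funext (heightProb_single 0)
  rcases n with _ | n
  · rw [psi_zero, e, h.eq_zero t ht]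
    ring
  · rw [psi_succ, e, heightProb_single, h.eq_succ n t ht]
    ring

mutual

theorem continuous_psi (h : IsRates lam mu y) :
    ∀ (T : RTree) (n : ℕ), Continuous (psi lam mu y T n)
  | node l, 0 => by
    have h1 := continuous_psiForest h l 0
    have h2 := continuous_expInt (lam := lam) (h.continuous 0)
    have := continuous_halfConv (h.continuous 0) (h2.mul h1)
    have e : psi lam mu y (node l) 0 = fun t =>
      mu * halfConv (y 0) (fun s => expInt lam (y 0) s * psiForest lam mu y l 0 s) t := by
      funext t; simp only [psi]
    rw [e]
    exact continuous_const.mul this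
  | node l, n + 1 => by
    have h1 := continuous_psiForest h l 0
    have h2 := continuous_expInt (lam := lam) (h.continuous 0)
    have h3 := continuous_psiForest h l n
    have h4 := continuous_expInt (lam := lam) (h.continuous n)
    have := continuous_halfConv (h.continuous (n + 1)) (h2.mul h1)
    have e : psi lam mu y (node l) (n + 1) = fun t =>
      expInt lam (y n) t * psiForest lam mu y l n t +
      mu * halfConv (y (n + 1)) (fun s => expInt lam (y 0) s * psiForest lam mu y l 0 s) t := by
      funext t; simp only [psi]
    rw [e]
    exact (h4.mul h3).add (continuous_const.mul this)

theorem continuous_psiForest (h : IsRates lam mu y) :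
    ∀ (l : List RTree) (n : ℕ), Continuous (psiForest lam mu y l n)
  | [], n => by
    have e : psiForest lam mu y [] n = fun _ => 1 := by funext t; simp only [psiForest]
    rw [e]
    exact continuous_const
  | c :: l, n => by
    have h1 := continuous_psi h c n
    have h2 := continuous_psiForest h l n
    have e : psiForest lam mu y (c :: l) n =
      fun t => psi lam mu y c n t * psiForest lam mu y l n t := by
      funext t; simp only [psiForest]
    rw [e]
    exact h1.mul h2

end

theorem continuous_heightProb (h : IsRates lam mu y) (T : RTree) (n : ℕ) :
    Continuous (heightProb lam mu y T n) := by
  rcases T with ⟨l⟩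
  exact (continuous_expInt (h.continuous n)).mul (continuous_psiForest h l n)

mutual

theorem psi_mem_Icc (h : IsRates lam mu y) (hlam : 0 < lam) (hmu : 0 < mu) :
    ∀ (T : RTree) (n : ℕ) (t : ℝ), 0 ≤ t → psi lam mu y T n t ∈ Icc 0 1
  | node l, n, t, ht => by
    have key : ∀ n s, 0 ≤ s → heightProb lam mu y (node l) n s ∈ Icc 0 (expInt lam (y n) s) := by
      intro n s hs
      have h1 := psiForest_mem_Icc h hlam hmu l n s hs
      exact ⟨mul_nonneg (expInt_pos _ _ _).le h1.1,
        mul_le_of_le_one_right (expInt_pos _ _ _).le h1.2⟩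
    have hle : psi lam mu y (node l) n t ≤ psi lam mu y single n t := by
      have hconv : ∀ n, halfConv (y n) (heightProb lam mu y (node l) 0) t ≤
          halfConv (y n) (heightProb lam mu y single 0) t := fun n =>
        halfConv_mono ht (h.continuous n) (h.continuous n) (continuous_heightProb h _ _)
          (continuous_heightProb h _ _) fun s hs hst => by
            rw [heightProb_single]
            exact mul_le_mul_of_nonneg_left (key 0 _ (by linarith)).2 (h.nonneg n s)
      rcases n with _ | n
      · rw [psi_zero, psi_zero]
        exact mul_le_mul_of_nonneg_left (hconv 0) hmu.le
      · rw [psi_succ, psi_succ, heightProb_single]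
        exact add_le_add (key n t ht).2 (mul_le_mul_of_nonneg_left (hconv _) hmu.le)
    refine ⟨?_, hle.trans ?_⟩
    · have hconv : ∀ n, 0 ≤ halfConv (y n) (heightProb lam mu y (node l) 0) t := fun n =>
        halfConv_nonneg ht (fun s _ => h.nonneg n s) fun s hs => (key 0 s hs).1
      rcases n with _ | n
      · rw [psi_zero]
        exact mul_nonneg hmu.le (hconv 0)
      · rw [psi_succ]
        exact add_nonneg (key n t ht).1 (mul_nonneg hmu.le (hconv _))
    · rw [psi_single h n ht]
      linarith [h.nonneg n t]

theorem psiForest_mem_Icc (h : IsRates lam mu y) (hlam : 0 < lam) (hmu : 0 < mu) :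
    ∀ (l : List RTree) (n : ℕ) (t : ℝ), 0 ≤ t → psiForest lam mu y l n t ∈ Icc 0 1
  | [], n, t, ht => by simp [psiForest]
  | c :: l, n, t, ht => by
    have h1 := psi_mem_Icc h hlam hmu c n t ht
    have h2 := psiForest_mem_Icc h hlam hmu l n t ht
    simp only [psiForest]
    exact ⟨mul_nonneg h1.1 h2.1, mul_le_one₀ h1.2 h2.1 h2.2⟩

end

theorem heightProb_mem_Icc (h : IsRates lam mu y) (hlam : 0 < lam) (hmu : 0 < mu) (T : RTree)
    (n : ℕ) {t : ℝ} (ht : 0 ≤ t) : heightProb lam mu y T n t ∈ Icc 0 1 := by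
  rcases T with ⟨l⟩
  have h1 := psiForest_mem_Icc h hlam hmu l n t ht
  have h2 := expInt_le_one hlam.le (h.nonneg n) ht
  exact ⟨mul_nonneg (expInt_pos _ _ _).le h1.1, mul_le_one₀ h2 h1.1 h1.2⟩

mutual

theorem psi_zero_right : ∀ (T : RTree) (n : ℕ),
    psi lam mu y T n 0 = if height T + 1 ≤ n then 1 else 0
  | node l, 0 => by simp [psi, halfConv]
  | node l, n + 1 => by
    have := psiForest_zero_right l n
    simp [psi, halfConv, this, expInt_zero, height]

theorem psiForest_zero_right : ∀ (l : List RTree) (n : ℕ),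
    psiForest lam mu y l n 0 = if heightForest l ≤ n then 1 else 0
  | [], n => by simp [psiForest, heightForest]
  | c :: l, n => by
    have h1 := psi_zero_right c n
    have h2 := psiForest_zero_right l n
    simp only [psiForest, heightForest, h1, h2, ite_mul, one_mul, zero_mul, max_le_iff]
    split_ifs <;> simp_all

end

theorem heightProb_zero_right (T : RTree) (n : ℕ) :
    heightProb lam mu y T n 0 = if height T ≤ n then 1 else 0 := by
  rcases T with ⟨l⟩
  have e : height (node l) = heightForest l := by simp only [height]
  rw [e]
  simp only [heightProb, expInt_zero, psiForest_zero_right, one_mul]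

end RTree

namespace RTree

variable {lam mu : ℝ} {y : ℕ → ℝ → ℝ}

theorem halfConv_sub_right {z U W : ℝ → ℝ} (hz : Continuous z) (hU : Continuous U)
    (hW : Continuous W) (t : ℝ) :
    halfConv z (fun s => U s - W s) t = halfConv z U t - halfConv z W t := by
  simp only [halfConv]
  rw [← intervalIntegral.integral_sub
    ((by fun_prop : Continuous fun s => z s * U (t - s)).intervalIntegrable _ _)
    ((by fun_prop : Continuous fun s => z s * W (t - s)).intervalIntegrable _ _)]
  congr 1; funext s; ring

theorem halfConv_generator {z : ℝ → ℝ} (hz : Continuous z) {f : RTree → ℝ → ℝ}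
    (hf : ∀ T, Continuous (f T)) (T : RTree) (t : ℝ) :
    halfConv z (fun s => generator lam mu (fun T => f T s) T) t =
      generator lam mu (fun T => halfConv z (f T) t) T := by
  have hadd : ∀ U W : ℝ → ℝ, Continuous U → Continuous W →
      halfConv z (fun s => U s + W s) t = halfConv z U t + halfConv z W t := by
    intro U W hU hW
    have := halfConv_sub_right (U := fun s => U s + W s) hz (by fun_prop) hW t
    simp only [add_sub_cancel_right] at this
    linarith
  have hmul : ∀ (c : ℝ) (U : ℝ → ℝ), halfConv z (fun s => c * U s) t = c * halfConv z U t := by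
    intro c U
    simp only [halfConv, ← intervalIntegral.integral_const_mul]
    congr 1; funext s; ring
  have hcont : ∀ L : List RTree, Continuous fun t => (L.map (fun T' => f T' t - f T t)).sum := by
    intro L
    induction L with
    | nil => simpa using continuous_const
    | cons a L ih =>
      simp only [List.map_cons, List.sum_cons]
      exact ((hf a).sub (hf T)).add ih
  have key : ∀ L : List RTree, halfConv z (fun s => (L.map (fun T' => f T' s - f T s)).sum) t =
      (L.map (fun T' => halfConv z (f T') t - halfConv z (f T) t)).sum := by
    intro L
    induction L with
    | nil => simp [halfConv]
    | cons a L ih =>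
      simp only [List.map_cons, List.sum_cons]
      rw [hadd (fun s => f a s - f T s) _ ((hf a).sub (hf T)) (hcont L), ih, halfConv_sub_right hz (hf a) (hf T)]
  simp only [generator]
  rw [hadd (fun s => lam * _) (fun s => mu * _) (continuous_const.mul (hcont _))
    (continuous_const.mul (hcont _)), hmul, hmul, key,
    key]

/-- The probability of having height at most `n` solves the backward equation. -/
def SolvesBackward (lam mu : ℝ) (y : ℕ → ℝ → ℝ) (T : RTree) : Prop :=
  ∀ n, ∃ D : ℝ → ℝ, Continuous D ∧ (∀ t, HasDerivAt (heightProb lam mu y T n) (D t) t) ∧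
    ∀ t, 0 ≤ t → D t = generator lam mu (fun T => heightProb lam mu y T n t) T

open Classical in
theorem hasDerivAt_psi (h : IsRates lam mu y) {T : RTree} (hT : SolvesBackward lam mu y T)
    (n : ℕ) : ∃ D : ℝ → ℝ, Continuous D ∧ (∀ t, HasDerivAt (psi lam mu y T n) (D t) t) ∧
      ∀ t, 0 ≤ t → D t = generator lam mu (fun T => psi lam mu y T n t) T +
        if T = single then mu * (1 - psi lam mu y T n t) else 0 := by
  obtain ⟨D₀, hD₀c, hD₀, hD₀g⟩ := hT 0
  have hzero : heightProb lam mu y T 0 0 = if T = single then 1 else 0 := by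
    rw [heightProb_zero_right]
    rcases T with ⟨_ | ⟨c, l⟩⟩
    · simp [height, heightForest, single]
    · simp [height, heightForest, single]
  have hconv : ∀ n t, 0 ≤ t → y n t * heightProb lam mu y T 0 0 + halfConv (y n) D₀ t =
      generator lam mu (fun T => halfConv (y n) (heightProb lam mu y T 0) t) T +
        if T = single then 1 - psi lam mu y T n t else 0 := by
    intro n t ht
    rw [← halfConv_generator (h.continuous n) (fun T => continuous_heightProb h T 0), hzero]
    have e : halfConv (y n) D₀ t = halfConv (y n)
        (fun s => generator lam mu (fun T => heightProb lam mu y T 0 s) T) t := by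
      refine intervalIntegral.integral_congr fun s hs => ?_
      rw [uIcc_of_le ht] at hs
      simp only
      rw [hD₀g _ (by linarith [hs.2])]
    rw [e]
    split_ifs with hs
    · rw [hs, psi_single h n ht]; ring
    · ring
  have hd : ∀ n t, HasDerivAt (halfConv (y n) (heightProb lam mu y T 0))
      (y n t * heightProb lam mu y T 0 0 + halfConv (y n) D₀ t) t := fun n t =>
    hasDerivAt_halfConv (h.continuous n) hD₀c hD₀ t
  have hc : ∀ n, Continuous fun t => y n t * heightProb lam mu y T 0 0 + halfConv (y n) D₀ t :=
    fun n => ((h.continuous n).mul continuous_const).add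
      (continuous_halfConv (h.continuous n) hD₀c)
  rcases n with _ | n
  · refine ⟨fun t => mu * _, continuous_const.mul (hc 0), fun t => ?_, fun t ht => ?_⟩
    · have e : psi lam mu y T 0 = fun t => mu * halfConv (y 0) (heightProb lam mu y T 0) t :=
        funext (psi_zero T)
      rw [e]
      exact (hd 0 t).const_mul mu
    · beta_reduce
      rw [hconv 0 t ht]
      simp only [psi_zero, generator_const_mul]
      rw [mul_add, mul_ite, mul_zero]
  · obtain ⟨D, hDc, hD, hDg⟩ := hT n
    refine ⟨fun t => D t + mu * _, hDc.add (continuous_const.mul (hc (n + 1))), fun t => ?_,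
      fun t ht => ?_⟩
    · have e : psi lam mu y T (n + 1) = fun t => heightProb lam mu y T n t +
          mu * halfConv (y (n + 1)) (heightProb lam mu y T 0) t :=
        funext (psi_succ T n)
      rw [e]
      exact (hD t).add ((hd (n + 1) t).const_mul mu)
    · beta_reduce
      rw [hconv (n + 1) t ht, hDg t ht]
      simp only [psi_succ, generator_const_mul, generator_add]
      rw [mul_add, mul_ite, mul_zero, add_assoc]

theorem hasDerivAt_heightProb_node (h : IsRates lam mu y) {l : List RTree}
    (hl : ∀ n, ∃ D : ℝ → ℝ, Continuous D ∧ (∀ t, HasDerivAt (psiForest lam mu y l n) (D t) t) ∧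
      ∀ t, 0 ≤ t → D t = generatorForest lam mu (fun l => psiForest lam mu y l n t) l) :
    SolvesBackward lam mu y (node l) := by
  intro n
  obtain ⟨D, hDc, hD, hDg⟩ := hl n
  have ha := hasDerivAt_expInt (lam := lam) (h.continuous n)
  refine ⟨fun t => -(lam * y n t) * expInt lam (y n) t * psiForest lam mu y l n t +
    expInt lam (y n) t * D t, ?_, fun t => ?_, fun t ht => ?_⟩
  · have := h.continuous n
    have := continuous_expInt (lam := lam) this
    have := continuous_psiForest h l n
    fun_prop
  · exact (ha t).mul (hD t)
  · have e : generatorForest lam mu (fun l => heightProb lam mu y (node l) n t) l =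
        expInt lam (y n) t * generatorForest lam mu (fun l => psiForest lam mu y l n t) l := by
      simp only [generatorForest, heightProb, sum_map_sub_mul]
      ring
    beta_reduce
    rw [generator_node, e, hDg t ht]
    simp only [heightProb, psiForest, psi_single h n ht]
    ring

mutual

theorem solvesBackward (h : IsRates lam mu y) : ∀ T : RTree, SolvesBackward lam mu y T
  | node l => hasDerivAt_heightProb_node h (hasDerivAt_psiForest h l)

theorem hasDerivAt_psiForest (h : IsRates lam mu y) : ∀ (l : List RTree) (n : ℕ),
    ∃ D : ℝ → ℝ, Continuous D ∧ (∀ t, HasDerivAt (psiForest lam mu y l n) (D t) t) ∧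
      ∀ t, 0 ≤ t → D t = generatorForest lam mu (fun l => psiForest lam mu y l n t) l
  | [], n => by
    refine ⟨fun _ => 0, continuous_const, fun t => ?_, fun t _ => ?_⟩
    · have e : psiForest lam mu y [] n = fun _ => 1 := by funext t; simp only [psiForest]
      rw [e]
      exact hasDerivAt_const t 1
    · simp [generatorForest, adjunctionsForest, deletionsForest]
  | c :: l, n => by
    obtain ⟨D, hDc, hD, hDg⟩ := hasDerivAt_psiForest h l n
    obtain ⟨E, hEc, hE, hEg⟩ := hasDerivAt_psi h (solvesBackward h c) n
    refine ⟨fun t => E t * psiForest lam mu y l n t + psi lam mu y c n t * D t, ?_, fun t => ?_,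
      fun t ht => ?_⟩
    · have := continuous_psi h c n
      have := continuous_psiForest h l n
      fun_prop
    · have e : psiForest lam mu y (c :: l) n =
        fun t => psi lam mu y c n t * psiForest lam mu y l n t := by
        funext t; simp only [psiForest]
      rw [e]
      exact (hE t).mul (hD t)
    · beta_reduce
      rw [generatorForest_cons lam mu (fun c => psi lam mu y c n t)
        (fun l => psiForest lam mu y l n t) (fun c l => by simp only [psiForest]), hEg t ht,
        hDg t ht]

end

end RTree

namespace RTree

variable {lam mu : ℝ} {y : ℕ → ℝ → ℝ}

theorem generator_eq_zero_of_size_lt {f : RTree → ℝ} {N : ℕ} (hf : ∀ T, N < size T → f T = 0)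
    {T : RTree} (hT : N + 1 < size T) : generator lam mu f T = 0 := by
  have h0 := hf T (by omega)
  have h1 : (adjunctions T).map (fun T' => f T' - f T) = (adjunctions T).map fun _ => 0 :=
    List.map_congr_left fun T' h => by
      rw [h0, hf T' (by have := size_of_mem_adjunctions T T' h; omega), sub_zero]
  have h2 : (deletions T).map (fun T' => f T' - f T) = (deletions T).map fun _ => 0 :=
    List.map_congr_left fun T' h => by
      rw [h0, hf T' (by have := size_of_mem_deletions T T' h; omega), sub_zero]
  simp [generator, h1, h2]

theorem finite_support_of_size_lt {f : RTree → ℝ} {N : ℕ} (hf : ∀ T, N < size T → f T = 0) :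
    (Function.support f).Finite := by
  refine (finite_size_le N).subset fun T hT => ?_
  by_contra h
  exact hT (hf T (by simpa using h))

theorem exists_size_bound {f : RTree → ℝ} (hf : (Function.support f).Finite) :
    ∃ N, ∀ T, N < size T → f T = 0 := by
  obtain ⟨N, hN⟩ := (hf.image size).bddAbove
  refine ⟨N, fun T hT => ?_⟩
  by_contra h
  exact absurd (hN ⟨T, h, rfl⟩) (by omega)

theorem finite_support_generator {f : RTree → ℝ} (hf : (Function.support f).Finite) :
    (Function.support (generator lam mu f)).Finite := by
  obtain ⟨N, hN⟩ := exists_size_bound hf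
  exact finite_support_of_size_lt (N := N + 1) fun T hT => generator_eq_zero_of_size_lt hN hT

theorem exists_bound_of_finite_support {f : RTree → ℝ} (hf : (Function.support f).Finite) :
    ∃ C, ∀ T, ‖f T‖ ≤ C := by
  obtain ⟨C, hC⟩ := (hf.image fun T => ‖f T‖).bddAbove
  refine ⟨max C 0, fun T => ?_⟩
  by_cases h : f T = 0
  · simp [h]
  · exact (hC ⟨T, h, rfl⟩).trans (le_max_left _ _)

end RTree

namespace RTree

theorem abs_generator_mul_sub_le (hlam : 0 ≤ lam) (hmu : 0 ≤ mu) {χ u : RTree → ℝ} {δ : ℝ}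
    (hδ : 0 ≤ δ) (hu : ∀ T, |u T| ≤ 1) {T : RTree}
    (hadj : ∀ T' ∈ adjunctions T, |χ T' - χ T| ≤ δ)
    (hdel : ∀ T' ∈ deletions T, |χ T' - χ T| ≤ δ) :
    |generator lam mu (fun T => χ T * u T) T - χ T * generator lam mu u T| ≤
      (lam + mu) * size T * δ := by
  have key : ∀ L : List RTree, (∀ T' ∈ L, |χ T' - χ T| ≤ δ) →
      |(L.map (fun T' => χ T' * u T' - χ T * u T)).sum -
        χ T * (L.map (fun T' => u T' - u T)).sum| ≤ L.length * δ := by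
    intro L hL
    induction L with
    | nil => simp
    | cons a L ih =>
      have h1 := ih fun T' h => hL T' (List.mem_cons_of_mem _ h)
      have h2 : |(χ a - χ T) * u a| ≤ δ := by
        rw [abs_mul]
        exact (mul_le_mul (hL a List.mem_cons_self) (hu a) (abs_nonneg _) hδ).trans_eq (mul_one δ)
      simp only [List.map_cons, List.sum_cons, List.length_cons]
      push_cast
      calc _ = |(χ a - χ T) * u a + ((L.map (fun T' => χ T' * u T' - χ T * u T)).sum -
            χ T * (L.map (fun T' => u T' - u T)).sum)| := by congr 1; ring
        _ ≤ _ := abs_add_le _ _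
        _ ≤ _ := by linarith
  have h1 := key _ hadj
  have h2 := key _ hdel
  rw [length_adjunctions] at h1
  have h3 : ((deletions T).length : ℝ) * δ ≤ size T * δ := by
    gcongr
    exact_mod_cast length_deletions_le T
  have h4 := h2.trans h3
  simp only [generator]
  calc _ = |lam * (((adjunctions T).map (fun T' => χ T' * u T' - χ T * u T)).sum -
          χ T * ((adjunctions T).map (fun T' => u T' - u T)).sum) +
        mu * (((deletions T).map (fun T' => χ T' * u T' - χ T * u T)).sum -
          χ T * ((deletions T).map (fun T' => u T' - u T)).sum)| := by congr 1; ring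
    _ ≤ _ := abs_add_le _ _
    _ ≤ lam * (size T * δ) + mu * (size T * δ) := by
      rw [abs_mul, abs_mul, abs_of_nonneg hlam, abs_of_nonneg hmu]
      gcongr
    _ = _ := by ring

/-- A cutoff function for the size of trees. -/
noncomputable def cutoff (N : ℕ) (T : RTree) : ℝ := max 0 (1 - size T / (N + 1))

theorem cutoff_nonneg (N : ℕ) (T : RTree) : 0 ≤ cutoff N T := le_max_left _ _

theorem cutoff_le_one (N : ℕ) (T : RTree) : cutoff N T ≤ 1 :=
  max_le zero_le_one (by linarith [show 0 ≤ (size T : ℝ) / (N + 1) by positivity])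

theorem cutoff_eq_zero {N : ℕ} {T : RTree} (h : N < size T) : cutoff N T = 0 := by
  refine max_eq_left ?_
  rw [sub_nonpos, le_div_iff₀ (by positivity)]
  exact_mod_cast (by omega : 1 * (N + 1) ≤ size T)

theorem tendsto_cutoff (T : RTree) : Tendsto (fun N => cutoff N T) atTop (𝓝 1) := by
  have h1 : Tendsto (fun N : ℕ => (size T : ℝ) * (1 / ((N : ℝ) + 1))) atTop
      (𝓝 (size T * 0)) := tendsto_one_div_add_atTop_nhds_zero_nat.const_mul _
  have h2 : Tendsto (fun N : ℕ => max 0 (1 - (size T : ℝ) * (1 / ((N : ℝ) + 1)))) atTop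
      (𝓝 (max 0 (1 - size T * 0))) := tendsto_const_nhds.max (h1.const_sub 1)
  simp only [mul_zero, sub_zero, mul_one_div] at h2
  rw [max_eq_right zero_le_one] at h2
  exact h2

theorem abs_cutoff_sub_le (N : ℕ) {T T' : RTree} (h : size T' = size T + 1) :
    |cutoff N T' - cutoff N T| ≤ 1 / (N + 1) := by
  refine (abs_max_sub_max_le_max _ _ _ _).trans ?_
  rw [h]
  push_cast
  have : (1 : ℝ) - (size T + 1) / (N + 1) - (1 - size T / (N + 1)) = -(1 / (N + 1)) := by ring
  rw [this, sub_self, abs_zero, abs_neg, abs_of_nonneg (by positivity)]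
  exact max_le (by positivity) le_rfl

/-- The error made by the cutoff in the generator. -/
noncomputable def cutoffError (lam mu : ℝ) (N : ℕ) (T : RTree) : ℝ :=
  if size T ≤ N + 1 then (lam + mu) * size T * (1 / (N + 1)) else 0

theorem abs_generator_cutoff_sub_le (hlam : 0 ≤ lam) (hmu : 0 ≤ mu) {u : RTree → ℝ}
    (hu : ∀ T, |u T| ≤ 1) (N : ℕ) (T : RTree) :
    |generator lam mu (fun T => cutoff N T * u T) T - cutoff N T * generator lam mu u T| ≤
      cutoffError lam mu N T := by
  unfold cutoffError
  split_ifs with h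
  · refine abs_generator_mul_sub_le hlam hmu (by positivity) hu (fun T' hT' => ?_) fun T' hT' => ?_
    · exact abs_cutoff_sub_le N (size_of_mem_adjunctions T T' hT')
    · rw [abs_sub_comm]
      exact abs_cutoff_sub_le N (size_of_mem_deletions T T' hT').symm
  · rw [generator_eq_zero_of_size_lt (N := N) (fun T hT => by rw [cutoff_eq_zero hT, zero_mul])
      (by omega), cutoff_eq_zero (by omega)]
    simp

theorem norm_cutoffError_le (hlam : 0 ≤ lam) (hmu : 0 ≤ mu) (N : ℕ) (T : RTree) :
    ‖cutoffError lam mu N T‖ ≤ lam + mu := by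
  unfold cutoffError
  split_ifs with h
  · rw [Real.norm_of_nonneg (by positivity), mul_one_div, div_le_iff₀ (by positivity)]
    gcongr
    exact_mod_cast h
  · simpa using by positivity

theorem tendsto_cutoffError (T : RTree) :
    Tendsto (fun N => cutoffError lam mu N T) atTop (𝓝 0) := by
  have h1 : Tendsto (fun N : ℕ => ((lam + mu) * size T) * (1 / ((N : ℝ) + 1))) atTop
      (𝓝 (((lam + mu) * size T) * 0)) := tendsto_one_div_add_atTop_nhds_zero_nat.const_mul _
  rw [mul_zero] at h1
  refine h1.congr' ?_
  filter_upwards [eventually_ge_atTop (size T)] with N hN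
  rw [cutoffError, if_pos (by omega)]

theorem finite_support_cutoffError (N : ℕ) :
    (Function.support (cutoffError lam mu N)).Finite :=
  finite_support_of_size_lt (N := N + 1) fun T hT => by
    rw [cutoffError, if_neg (by omega)]

end RTree

section Chain

variable {Ω : Type*} {mΩ : MeasurableSpace Ω} {P : Measure Ω} {lam mu : ℝ} {G : ℝ≥0 → Ω → RTree}

/-- The mean value of a function of the chain. -/
noncomputable def chainMean (P : Measure Ω) (G : ℝ≥0 → Ω → RTree) (f : RTree → ℝ) (t : ℝ) : ℝ :=
  ∫ ω, f (G t.toNNReal ω) ∂P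

namespace IsTreeChain

theorem measurable_chain (hG : IsTreeChain P lam mu G) (t : ℝ≥0) : Measurable (G t) := by
  obtain ⟨ℱ, h, -⟩ := hG.martingale
  exact (h t).mono (ℱ.le t) le_rfl

theorem measurable_comp (hG : IsTreeChain P lam mu G) (f : RTree → ℝ) (t : ℝ≥0) :
    Measurable fun ω => f (G t ω) :=
  (measurable_from_top (f := f)).comp (hG.measurable_chain t)

theorem measurable_comp_countable (hG : IsTreeChain P lam mu G) (f : RTree → ℝ) (d : ℕ → ℝ≥0)
    {k : ℝ × Ω → ℕ} (hk : Measurable k) : Measurable fun p => f (G (d (k p)) p.2) := by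
  have h1 : Measurable fun q : ℕ × Ω => f (G (d q.1) q.2) :=
    measurable_from_prod_countable_right fun k => hG.measurable_comp f (d k)
  exact h1.comp (hk.prodMk measurable_snd)

theorem measurable_uncurry (hG : IsTreeChain P lam mu G) (f : RTree → ℝ) :
    Measurable fun p : ℝ × Ω => f (G p.1.toNNReal p.2) := by
  let d : ℕ → ℕ → ℝ≥0 := fun n k => (k + 1) / (n + 1)
  have hd : ∀ n, Measurable fun p : ℝ × Ω =>
      f (G (d n ⌊(n + 1) * p.1.toNNReal⌋₊) p.2) := by
    intro n
    refine hG.measurable_comp_countable f (d n)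
      (k := fun p : ℝ × Ω => ⌊((n : ℝ≥0) + 1) * p.1.toNNReal⌋₊) (Nat.measurable_floor.comp ?_)
    fun_prop
  refine measurable_of_tendsto_metrizable hd ?_
  rw [tendsto_pi_nhds]
  rintro ⟨s, ω⟩
  simp only
  set t := s.toNNReal
  have hlt : ∀ n : ℕ, t < d n ⌊(n + 1) * t⌋₊ := by
    intro n
    rw [lt_div_iff₀ (by positivity), mul_comm]
    exact Nat.lt_floor_add_one _
  have hle : ∀ n : ℕ, d n ⌊(n + 1) * t⌋₊ ≤ t + 1 / (n + 1) := by
    intro n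
    have : t + 1 / ((n : ℝ≥0) + 1) = ((n + 1) * t + 1) / (n + 1) := by field_simp
    rw [this]
    simp only [d]
    gcongr
    exact Nat.floor_le (by positivity)
  have hlim : Tendsto (fun n : ℕ => d n ⌊(n + 1) * t⌋₊) atTop (𝓝[>] t) := by
    refine tendsto_nhdsWithin_iff.2 ⟨?_, Eventually.of_forall hlt⟩
    refine tendsto_of_tendsto_of_tendsto_of_le_of_le tendsto_const_nhds ?_ (fun n => (hlt n).le) hle
    have : Tendsto (fun n : ℕ => t + 1 / ((n : ℝ≥0) + 1)) atTop (𝓝 (t + 0)) :=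
      tendsto_const_nhds.add tendsto_one_div_add_atTop_nhds_zero_nat
    simpa using this
  refine tendsto_const_nhds.congr' ?_
  filter_upwards [hlim.eventually (hG.right_continuous ω t)] with n hn
  rw [hn]

variable [IsProbabilityMeasure P]

theorem integrable_comp (hG : IsTreeChain P lam mu G) {f : RTree → ℝ} {C : ℝ}
    (hf : ∀ T, ‖f T‖ ≤ C) (t : ℝ≥0) : Integrable (fun ω => f (G t ω)) P :=
  Integrable.of_bound (hG.measurable_comp f t).aestronglyMeasurable C
    (Eventually.of_forall fun _ => hf _)

theorem norm_chainMean_le {f : RTree → ℝ} {C : ℝ}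
    (hf : ∀ T, ‖f T‖ ≤ C) (t : ℝ) : ‖chainMean P G f t‖ ≤ C := by
  have := norm_integral_le_of_norm_le_const (μ := P) (C := C)
    (f := fun ω => f (G t.toNNReal ω)) (Eventually.of_forall fun ω => hf _)
  simpa [chainMean] using this

theorem intervalIntegrable_chainMean (hG : IsTreeChain P lam mu G) {f : RTree → ℝ} {C : ℝ}
    (hf : ∀ T, ‖f T‖ ≤ C) (a b : ℝ) : IntervalIntegrable (chainMean P G f) volume a b := by
  have hm : StronglyMeasurable (chainMean P G f) :=
    StronglyMeasurable.integral_prod_right (f := fun (s : ℝ) ω => f (G s.toNNReal ω))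
      (hG.measurable_uncurry f).stronglyMeasurable
  refine (intervalIntegrable_const (c := C)).mono_fun' hm.aestronglyMeasurable ?_
  exact Eventually.of_forall fun t => norm_chainMean_le hf t

/-- The forward equation of the chain. -/
theorem chainMean_eq (hG : IsTreeChain P lam mu G) {f : RTree → ℝ}
    (hf : (Function.support f).Finite) {t : ℝ} (ht : 0 ≤ t) :
    chainMean P G f t = f RTree.single +
      ∫ s in (0 : ℝ)..t, chainMean P G (RTree.generator lam mu f) s := by
  obtain ⟨ℱ, -, hM⟩ := hG.martingale
  have hM := hM f hf
  obtain ⟨C, hC⟩ := RTree.exists_bound_of_finite_support hf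
  obtain ⟨D, hD⟩ := RTree.exists_bound_of_finite_support
    (RTree.finite_support_generator (lam := lam) (mu := mu) hf)
  have h1 := hM.setIntegral_eq (zero_le (a := t.toNNReal)) MeasurableSet.univ
  simp only [Measure.restrict_univ, NNReal.coe_zero, intervalIntegral.integral_same,
    sub_zero] at h1
  have hint : Integrable (Function.uncurry fun s ω =>
      RTree.generator lam mu f (G (Real.toNNReal s) ω))
      ((volume.restrict (uIoc 0 t)).prod P) := by
    have : IsFiniteMeasure ((volume : Measure ℝ).restrict (uIoc 0 t)) := by
      unfold uIoc; infer_instance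
    refine Integrable.of_bound (C := D) ?_ (Eventually.of_forall fun _ => hD _)
    exact (hG.measurable_uncurry (RTree.generator lam mu f)).aestronglyMeasurable
  have hswap := intervalIntegral_integral_swap hint
  rw [integral_sub (hG.integrable_comp hC _), Real.coe_toNNReal t ht] at h1
  · have h0 : ∫ ω, f (G 0 ω) ∂P = f RTree.single := by
      have : (fun ω => f (G 0 ω)) =ᵐ[P] fun _ => f RTree.single := by
        filter_upwards [hG.start] with ω hω
        rw [hω]
      rw [integral_congr_ae this]
      simp
    rw [h0] at h1
    simp only [chainMean]
    rw [hswap]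
    linarith
  · have := (hM.integrable t.toNNReal).sub (hG.integrable_comp hC t.toNNReal)
    refine this.neg.congr (Eventually.of_forall fun ω => ?_)
    simp

theorem continuous_chainMean (hG : IsTreeChain P lam mu G) {f : RTree → ℝ}
    (hf : (Function.support f).Finite) : Continuous (chainMean P G f) := by
  obtain ⟨D, hD⟩ := RTree.exists_bound_of_finite_support
    (RTree.finite_support_generator (lam := lam) (mu := mu) hf)
  have h1 : Continuous fun t : ℝ => f RTree.single +
      ∫ s in (0 : ℝ)..(max t 0), chainMean P G (RTree.generator lam mu f) s :=
    continuous_const.add ((intervalIntegral.continuous_primitive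
      (fun a b => hG.intervalIntegrable_chainMean hD a b) 0).comp (by fun_prop))
  refine h1.congr fun t => ?_
  rw [← hG.chainMean_eq hf (le_max_right t 0)]
  simp only [chainMean]
  congr 2
  simp [Real.toNNReal]

theorem hasDerivAt_chainMean (hG : IsTreeChain P lam mu G) {f : RTree → ℝ}
    (hf : (Function.support f).Finite) {t : ℝ} (ht : 0 < t) :
    HasDerivAt (chainMean P G f) (chainMean P G (RTree.generator lam mu f) t) t := by
  have hc := hG.continuous_chainMean (RTree.finite_support_generator (lam := lam) (mu := mu) hf)
  refine ((hc.integral_hasStrictDerivAt 0 t).hasDerivAt.const_add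
    (f RTree.single)).congr_of_eventuallyEq ?_
  filter_upwards [lt_mem_nhds ht] with s hs
  exact hG.chainMean_eq hf hs.le


theorem chainMean_sum (hG : IsTreeChain P lam mu G) {ι : Type*} (F : Finset ι) (c : ι → ℝ)
    {f : ι → RTree → ℝ} (hf : ∀ i, (Function.support (f i)).Finite) (s : ℝ) :
    chainMean P G (fun T => ∑ i ∈ F, c i * f i T) s = ∑ i ∈ F, c i * chainMean P G (f i) s := by
  simp only [chainMean]
  rw [integral_finsetSum]
  · simp only [integral_const_mul]
  · intro i _
    obtain ⟨C, hC⟩ := RTree.exists_bound_of_finite_support (hf i)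
    exact (hG.integrable_comp hC _).const_mul _

open Classical in
/-- The mean of a time-dependent function of the chain is differentiable; its derivative is the
mean of the time derivative plus the generator. -/
theorem exists_deriv_chainMean (hG : IsTreeChain P lam mu G) {g g' : RTree → ℝ → ℝ} {N : ℕ}
    (hg : ∀ T s, HasDerivAt (g T) (g' T s) s) (hgc : ∀ T, Continuous (g' T))
    (h0 : ∀ T s, N < RTree.size T → g T s = 0) (h0' : ∀ T s, N < RTree.size T → g' T s = 0) :
    Continuous (fun s => chainMean P G (fun T => g T s) s) ∧
    Continuous (fun s => chainMean P G
      (fun T => g' T s + RTree.generator lam mu (fun T => g T s) T) s) ∧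
    ∀ s, 0 < s → HasDerivAt (fun s => chainMean P G (fun T => g T s) s) (chainMean P G
      (fun T => g' T s + RTree.generator lam mu (fun T => g T s) T) s) s := by
  set F := (RTree.finite_size_le N).toFinset with hF
  let ind : RTree → RTree → ℝ := fun T₀ T => if T = T₀ then 1 else 0
  have hind : ∀ T₀, (Function.support (ind T₀)).Finite := fun T₀ =>
    (Set.finite_singleton T₀).subset fun T hT => by
      by_contra h
      exact hT (if_neg h)
  have hdec : ∀ f : RTree → ℝ, (∀ T, N < RTree.size T → f T = 0) →
      f = fun T => ∑ T₀ ∈ F, f T₀ * ind T₀ T := by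
    intro f hf
    funext T
    simp only [ind, mul_ite, mul_one, mul_zero, Finset.sum_ite_eq]
    split_ifs with h
    · rfl
    · exact hf T (by simpa [hF] using h)
  have e1 : (fun s => chainMean P G (fun T => g T s) s) =
      fun s => ∑ T₀ ∈ F, g T₀ s * chainMean P G (ind T₀) s := by
    funext s
    conv_lhs => rw [hdec (fun T => g T s) fun T => h0 T s]
    exact hG.chainMean_sum F _ hind s
  have hgen : ∀ T₀, (Function.support (RTree.generator lam mu (ind T₀))).Finite := fun T₀ =>
    RTree.finite_support_generator (hind T₀)
  have e2 : (fun s => chainMean P G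
      (fun T => g' T s + RTree.generator lam mu (fun T => g T s) T) s) =
      fun s => ∑ T₀ ∈ F, (g' T₀ s * chainMean P G (ind T₀) s +
        g T₀ s * chainMean P G (RTree.generator lam mu (ind T₀)) s) := by
    funext s
    have hs : (fun T => g' T s + RTree.generator lam mu (fun T => g T s) T) = fun T =>
        (∑ T₀ ∈ F, g' T₀ s * ind T₀ T) +
          ∑ T₀ ∈ F, g T₀ s * RTree.generator lam mu (ind T₀) T := by
      funext T
      congr 1
      · exact congrFun (hdec (fun T => g' T s) fun T => h0' T s) T
      · rw [hdec (fun T => g T s) fun T => h0 T s, RTree.generator_finset_sum]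
        simp only [RTree.generator_const_mul]
    rw [hs, Finset.sum_add_distrib, ← hG.chainMean_sum F _ hind, ← hG.chainMean_sum F _ hgen]
    simp only [chainMean]
    rw [integral_add]
    · refine integrable_finsetSum _ fun i _ => ?_
      obtain ⟨C, hC⟩ := RTree.exists_bound_of_finite_support (hind i)
      exact (hG.integrable_comp hC _).const_mul _
    · refine integrable_finsetSum _ fun i _ => ?_
      obtain ⟨C, hC⟩ := RTree.exists_bound_of_finite_support (hgen i)
      exact (hG.integrable_comp hC _).const_mul _
  have hgcont : ∀ T, Continuous (g T) := fun T =>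
    continuous_iff_continuousAt.2 fun s => (hg T s).continuousAt
  refine ⟨?_, ?_, fun s hs => ?_⟩
  · rw [e1]
    exact continuous_finsetSum _ fun T₀ _ => (hgcont T₀).mul (hG.continuous_chainMean (hind T₀))
  · rw [e2]
    exact continuous_finsetSum _ fun T₀ _ =>
      ((hgc T₀).mul (hG.continuous_chainMean (hind T₀))).add
        ((hgcont T₀).mul (hG.continuous_chainMean (hgen T₀)))
  · have := congrFun e2 s
    beta_reduce at this
    rw [e1, this]
    exact HasDerivAt.fun_sum fun T₀ _ => (hg T₀ s).mul (hG.hasDerivAt_chainMean (hind T₀) hs)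

theorem tendsto_chainMean (hG : IsTreeChain P lam mu G) {f : ℕ → RTree → ℝ} {g : RTree → ℝ}
    {C : ℝ} (hf : ∀ N T, ‖f N T‖ ≤ C) (h : ∀ T, Tendsto (fun N => f N T) atTop (𝓝 (g T)))
    (t : ℝ) : Tendsto (fun N => chainMean P G (f N) t) atTop (𝓝 (chainMean P G g t)) :=
  tendsto_integral_of_dominated_convergence (fun _ => C)
    (fun N => (hG.measurable_comp (f N) _).aestronglyMeasurable) (integrable_const C)
    (fun N => Eventually.of_forall fun _ => hf N _) (Eventually.of_forall fun _ => h _)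

theorem abs_chainMean_le (hG : IsTreeChain P lam mu G) {f g : RTree → ℝ} {C : ℝ}
    (hg : ∀ T, ‖g T‖ ≤ C) (h : ∀ T, |f T| ≤ g T) (t : ℝ) :
    |chainMean P G f t| ≤ chainMean P G g t :=
  norm_integral_le_of_norm_le (f := fun ω => f (G t.toNNReal ω)) (hG.integrable_comp hg _)
    (Eventually.of_forall fun _ => h _)

/-- The distribution of the height of the chain. -/
theorem chainMean_height_le (hG : IsTreeChain P lam mu G) (hlam : 0 < lam) (hmu : 0 < mu)
    {y : ℕ → ℝ → ℝ} (h : IsRates lam mu y) (n : ℕ) {t : ℝ} (ht : 0 ≤ t) :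
    chainMean P G (fun T => RTree.heightProb lam mu y T n 0) t = expInt lam (y n) t := by
  set u : RTree → ℝ → ℝ := fun T s => RTree.heightProb lam mu y T n s with hu
  have hu1 : ∀ s, 0 ≤ s → ∀ T, |u T s| ≤ 1 := fun s hs T => by
    have := RTree.heightProb_mem_Icc h hlam hmu T n hs
    rw [abs_of_nonneg this.1]
    exact this.2
  choose D hDc hD hDg using fun T => RTree.solvesBackward h T n
  let M : ℕ → ℝ → ℝ := fun N s => chainMean P G (fun T => RTree.cutoff N T * u T (t - s)) s
  have hcut : ∀ N s, 0 ≤ s → ∀ T, ‖RTree.cutoff N T * u T s‖ ≤ 1 := fun N s hs T => by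
    rw [norm_mul, Real.norm_of_nonneg (RTree.cutoff_nonneg N T)]
    exact mul_le_one₀ (RTree.cutoff_le_one N T) (norm_nonneg _) (hu1 s hs T)
  have hbound : ∀ N, |M N t - M N 0| ≤
      ∫ s in (0 : ℝ)..t, chainMean P G (RTree.cutoffError lam mu N) s := by
    intro N
    obtain ⟨hc, hc', hder⟩ := hG.exists_deriv_chainMean (N := N)
      (g := fun T s => RTree.cutoff N T * u T (t - s))
      (g' := fun T s => RTree.cutoff N T * -D T (t - s))
      (fun T s => ((hD T (t - s)).comp_const_sub t s).const_mul _)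
      (fun T => by have := hDc T; fun_prop)
      (fun T s hT => by rw [RTree.cutoff_eq_zero hT, zero_mul])
      (fun T s hT => by rw [RTree.cutoff_eq_zero hT, zero_mul])
    have e := intervalIntegral.integral_eq_sub_of_hasDerivAt_of_le ht hc.continuousOn
      (fun s hs => hder s hs.1) (hc'.intervalIntegrable _ _)
    change |chainMean P G (fun T => RTree.cutoff N T * u T (t - t)) t -
      chainMean P G (fun T => RTree.cutoff N T * u T (t - 0)) 0| ≤ _
    rw [← e, ← Real.norm_eq_abs]
    refine intervalIntegral.norm_integral_le_of_norm_le ht (Eventually.of_forall fun s hs => ?_)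
      (hG.intervalIntegrable_chainMean (RTree.norm_cutoffError_le hlam.le hmu.le N) _ _)
    refine hG.abs_chainMean_le (RTree.norm_cutoffError_le hlam.le hmu.le N) (fun T => ?_) s
    have hts : 0 ≤ t - s := by linarith [hs.2]
    have := RTree.abs_generator_cutoff_sub_le hlam.le hmu.le (hu1 _ hts) N T
    rw [hDg T _ hts]
    convert this using 2
    ring
  have hzero : Tendsto (fun N => ∫ s in (0 : ℝ)..t,
      chainMean P G (RTree.cutoffError lam mu N) s) atTop (𝓝 0) := by
    have := intervalIntegral.tendsto_integral_filter_of_dominated_convergence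
      (μ := volume) (a := 0) (b := t) (l := atTop)
      (F := fun N s => chainMean P G (RTree.cutoffError lam mu N) s) (f := fun _ => 0)
      (fun _ => lam + mu)
      (Eventually.of_forall fun N => (hG.continuous_chainMean
        (RTree.finite_support_cutoffError N)).aestronglyMeasurable)
      (Eventually.of_forall fun N => Eventually.of_forall fun s _ =>
        norm_chainMean_le (RTree.norm_cutoffError_le hlam.le hmu.le N) s)
      intervalIntegrable_const
      (Eventually.of_forall fun s _ => by
        have := hG.tendsto_chainMean (RTree.norm_cutoffError_le hlam.le hmu.le)
          RTree.tendsto_cutoffError s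
        simpa [chainMean] using this)
    simpa using this
  have hMt : Tendsto (fun N => M N t) atTop
      (𝓝 (chainMean P G (fun T => RTree.heightProb lam mu y T n 0) t)) := by
    simp only [M, sub_self]
    refine hG.tendsto_chainMean (fun N => hcut N 0 le_rfl) (fun T => ?_) t
    simpa using (RTree.tendsto_cutoff T).mul_const (u T 0)
  have hM0 : Tendsto (fun N => M N 0) atTop (𝓝 (expInt lam (y n) t)) := by
    have e : ∀ N, M N 0 = RTree.cutoff N RTree.single * u RTree.single t := by
      intro N
      have := hG.chainMean_eq (f := fun T => RTree.cutoff N T * u T t)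
        (RTree.finite_support_of_size_lt (N := N) fun T hT => by
          rw [RTree.cutoff_eq_zero hT, zero_mul]) le_rfl
      simp only [intervalIntegral.integral_same, add_zero] at this
      simp only [M, sub_zero]
      exact this
    simp only [e]
    have := (RTree.tendsto_cutoff RTree.single).mul_const (u RTree.single t)
    rw [one_mul] at this
    rwa [← RTree.heightProb_single (mu := mu)]
  have hdiff := (hMt.sub hM0).abs
  have := squeeze_zero (fun N => abs_nonneg _) hbound hzero
  have := tendsto_nhds_unique hdiff this
  exact sub_eq_zero.1 (abs_eq_zero.1 this)

theorem prob_height_le (hG : IsTreeChain P lam mu G) (hlam : 0 < lam) (hmu : 0 < mu)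
    {y : ℕ → ℝ → ℝ} (h : IsRates lam mu y) (n : ℕ) (t : ℝ≥0) :
    P.real {ω | (G t ω).height ≤ n} = expInt lam (y n) t := by
  rw [← hG.chainMean_height_le hlam hmu h n t.coe_nonneg]
  have hm : MeasurableSet {ω | (G t ω).height ≤ n} :=
    measurableSet_preimage (hG.measurable_chain t) (t := {T : RTree | T.height ≤ n}) trivial
  rw [← integral_indicator_one hm]
  simp only [chainMean, Real.toNNReal_coe, RTree.heightProb_zero_right]
  congr 1
  funext ω
  simp [Set.indicator_apply]

end IsTreeChain

end Chain

section Schroder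

/-- The probability that a vertex with Poisson(`r`) children has a child in a set of probability
`x`. -/
noncomputable def poissonMap (r x : ℝ) : ℝ := 1 - Real.exp (-(r * x))

theorem exp_neg_le_quadratic {u : ℝ} (hu : 0 ≤ u) : Real.exp (-u) ≤ 1 - u + u ^ 2 / 2 := by
  have h1 := Real.quadratic_le_exp_of_nonneg hu
  rw [Real.exp_neg, inv_le_iff_one_le_mul₀ (Real.exp_pos _)]
  have h2 : 0 < 1 - u + u ^ 2 / 2 := by nlinarith [sq_nonneg (u - 1)]
  nlinarith [sq_nonneg (u ^ 2)]

theorem poissonMap_le (r x : ℝ) : poissonMap r x ≤ r * x := by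
  have := Real.add_one_le_exp (-(r * x))
  simp only [poissonMap]
  linarith

theorem le_poissonMap {r x : ℝ} (h : 0 ≤ r * x) : r * x - (r * x) ^ 2 / 2 ≤ poissonMap r x := by
  have := exp_neg_le_quadratic h
  simp only [poissonMap]
  linarith

theorem poissonMap_pos {r x : ℝ} (hr : 0 < r) (hx : 0 < x) : 0 < poissonMap r x := by
  have : Real.exp (-(r * x)) < 1 := by
    rw [Real.exp_lt_one_iff]
    have := mul_pos hr hx
    linarith
  simp only [poissonMap]
  linarith

theorem poissonMap_zero (r : ℝ) : poissonMap r 0 = 0 := by simp [poissonMap]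

theorem poissonMap_nonneg {r x : ℝ} (hr : 0 < r) (hx : 0 ≤ x) : 0 ≤ poissonMap r x := by
  rcases hx.eq_or_lt with rfl | hx
  · rw [poissonMap_zero]
  · exact (poissonMap_pos hr hx).le

theorem poissonMap_iterate_pos {r x : ℝ} (hr : 0 < r) (hx : 0 < x) (n : ℕ) :
    0 < (poissonMap r)^[n] x := by
  induction n with
  | zero => exact hx
  | succ n ih => rw [Function.iterate_succ_apply']; exact poissonMap_pos hr ih

theorem poissonMap_iterate_nonneg {r x : ℝ} (hr : 0 < r) (hx : 0 ≤ x) (n : ℕ) :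
    0 ≤ (poissonMap r)^[n] x := by
  induction n with
  | zero => exact hx
  | succ n ih => rw [Function.iterate_succ_apply']; exact poissonMap_nonneg hr ih

theorem poissonMap_iterate_le {r : ℝ} (hr : 0 < r) (x : ℝ) (n : ℕ) :
    (poissonMap r)^[n] x ≤ r ^ n * x := by
  induction n with
  | zero => simp
  | succ n ih =>
    rw [Function.iterate_succ_apply']
    refine (poissonMap_le _ _).trans ?_
    rw [pow_succ']
    nlinarith

theorem continuous_poissonMap (r : ℝ) : Continuous (poissonMap r) := by
  unfold poissonMap
  fun_prop

theorem tendsto_poissonMap_iterate {r x : ℝ} (hr : 0 < r) (hr1 : r < 1) (hx : 0 ≤ x) :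
    Tendsto (fun n => (poissonMap r)^[n] x) atTop (𝓝 0) := by
  refine squeeze_zero (poissonMap_iterate_nonneg hr hx) (poissonMap_iterate_le hr x) ?_
  simpa using (tendsto_pow_atTop_nhds_zero_of_lt_one hr.le hr1).mul_const x

/-- The Koenigs function of `poissonMap r` at its fixed point `0`. -/
noncomputable def koenigs (r x : ℝ) : ℝ := limUnder atTop fun n => (poissonMap r)^[n] x / r ^ n

theorem exists_koenigs {r x : ℝ} (hr : 0 < r) (hr1 : r < 1) (hx : 0 ≤ x) :
    ∃ L, Tendsto (fun n => (poissonMap r)^[n] x / r ^ n) atTop (𝓝 L) ∧ L ≤ x ∧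
      x - r * x ^ 2 / (2 * (1 - r)) ≤ L := by
  set a : ℕ → ℝ := fun n => (poissonMap r)^[n] x / r ^ n with ha
  have hanti : Antitone a := antitone_nat_of_succ_le fun n => by
    simp only [ha]
    rw [div_le_div_iff₀ (by positivity) (by positivity), Function.iterate_succ_apply', pow_succ]
    have := poissonMap_le r ((poissonMap r)^[n] x)
    nlinarith [pow_pos hr n]
  have hlow : ∀ n, x - r * x ^ 2 / (2 * (1 - r)) * (1 - r ^ n) ≤ a n := by
    intro n
    induction n with
    | zero => simp [ha]
    | succ n ih =>
      set z := (poissonMap r)^[n] x with hz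
      have hz0 : 0 ≤ z := poissonMap_iterate_nonneg hr hx n
      have hz1 : z ≤ r ^ n * x := poissonMap_iterate_le hr x n
      have h1 := le_poissonMap (mul_nonneg hr.le hz0)
      have h2 : a (n + 1) = poissonMap r z / r ^ (n + 1) := by
        simp only [ha]; rw [Function.iterate_succ_apply']
      have h3 : z / r ^ n - r ^ (n + 1) * x ^ 2 / 2 ≤ a (n + 1) := by
        rw [h2, le_div_iff₀ (by positivity)]
        have hz2 : z ^ 2 ≤ (r ^ n * x) ^ 2 := by gcongr
        have : (z / r ^ n - r ^ (n + 1) * x ^ 2 / 2) * r ^ (n + 1) =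
            r * z - r ^ 2 * (r ^ n * x) ^ 2 / 2 := by
          field_simp; ring
        rw [this]
        nlinarith [sq_nonneg r]
      have h4 : r * x ^ 2 / (2 * (1 - r)) * (1 - r ^ (n + 1)) =
          r * x ^ 2 / (2 * (1 - r)) * (1 - r ^ n) + r ^ (n + 1) * x ^ 2 / 2 := by
        have : (1 - r) ≠ 0 := by linarith
        field_simp; ring
      have h5 : a n = z / r ^ n := rfl
      linarith
  have hnn : ∀ n, 0 ≤ a n := fun n => div_nonneg (poissonMap_iterate_nonneg hr hx n) (by positivity)
  have hlim := tendsto_atTop_ciInf hanti ⟨0, by rintro _ ⟨n, rfl⟩; exact hnn n⟩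
  refine ⟨_, hlim, ?_, ?_⟩
  · have := hanti.le_of_tendsto hlim 0
    simpa [ha] using this
  · refine ge_of_tendsto' hlim fun n => le_trans ?_ (hlow n)
    have h1 : 0 ≤ r * x ^ 2 / (2 * (1 - r)) :=
      div_nonneg (by positivity) (by linarith)
    nlinarith [pow_pos hr n]

theorem tendsto_koenigs {r x : ℝ} (hr : 0 < r) (hr1 : r < 1) (hx : 0 ≤ x) :
    Tendsto (fun n => (poissonMap r)^[n] x / r ^ n) atTop (𝓝 (koenigs r x)) := by
  obtain ⟨L, hL, -⟩ := exists_koenigs hr hr1 hx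
  rw [koenigs, hL.limUnder_eq]
  exact hL

theorem abs_koenigs_sub_le {r x : ℝ} (hr : 0 < r) (hr1 : r < 1) (hx : 0 ≤ x) :
    |x - koenigs r x| ≤ r * x ^ 2 / (2 * (1 - r)) := by
  obtain ⟨L, hL, h1, h2⟩ := exists_koenigs hr hr1 hx
  rw [koenigs, hL.limUnder_eq, abs_of_nonneg (by linarith)]
  linarith

theorem koenigs_iterate_of_tendsto {r x L : ℝ} (N : ℕ)
    (h : Tendsto (fun n => (poissonMap r)^[n] ((poissonMap r)^[N] x) / r ^ n) atTop (𝓝 L)) :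
    Tendsto (fun n => (poissonMap r)^[n] x / r ^ n) atTop (𝓝 (L / r ^ N)) := by
  rw [← tendsto_add_atTop_iff_nat N]
  refine (h.div_const (r ^ N)).congr fun n => ?_
  rw [Function.iterate_add_apply, pow_add, div_div]

theorem koenigs_iterate {r x : ℝ} (hr : 0 < r) (hr1 : r < 1) (hx : 0 ≤ x) (n : ℕ) :
    koenigs r ((poissonMap r)^[n] x) = r ^ n * koenigs r x := by
  have h1 := koenigs_iterate_of_tendsto n
    (tendsto_koenigs hr hr1 (poissonMap_iterate_nonneg hr hx n))
  rw [tendsto_nhds_unique (tendsto_koenigs hr hr1 hx) h1]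
  field_simp

theorem koenigs_pos {r x : ℝ} (hr : 0 < r) (hr1 : r < 1) (hx : 0 < x) : 0 < koenigs r x := by
  have hlim := tendsto_poissonMap_iterate hr hr1 hx.le
  obtain ⟨n, hn⟩ := (hlim.eventually (gt_mem_nhds (show (0 : ℝ) < 2 * (1 - r) by linarith))).exists
  set z := (poissonMap r)^[n] x with hz
  have hz0 : 0 < z := poissonMap_iterate_pos hr hx n
  have h1 := abs_koenigs_sub_le hr hr1 hz0.le
  have h2 := koenigs_iterate hr hr1 hx.le n
  rw [← hz] at h2
  have h3 : r * z ^ 2 / (2 * (1 - r)) < z := by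
    rw [div_lt_iff₀ (by linarith)]
    nlinarith
  have h4 : 0 < koenigs r z := by linarith [(abs_le.1 h1).2]
  rw [h2] at h4
  exact pos_of_mul_pos_right h4 (by positivity)

theorem cast_poissonMap_iterate (r x : ℝ) (n : ℕ) :
    (((poissonMap r)^[n] x : ℝ) : ℂ) = (fun z : ℂ => 1 - Complex.exp (-(r * z)))^[n] x := by
  induction n with
  | zero => rfl
  | succ n ih =>
    rw [Function.iterate_succ_apply', Function.iterate_succ_apply', ← ih]
    simp [poissonMap]

/-- Convergence of the Koenigs iteration on a complex disc. -/
theorem exists_complex_koenigs {r : ℝ} (hr : 0 < r) (hr1 : r < 1) :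
    ∃ δ > 0, ∃ F : ℂ → ℂ, DifferentiableOn ℂ F (Metric.ball 0 δ) ∧
      (∃ C, ∀ z ∈ Metric.ball (0 : ℂ) δ, ‖F z - z‖ ≤ C * ‖z‖ ^ 2) ∧
      ∀ z ∈ Metric.ball (0 : ℂ) δ, Tendsto
        (fun n => (fun z : ℂ => 1 - Complex.exp (-(r * z)))^[n] z / (r : ℂ) ^ n) atTop
        (𝓝 (F z)) := by
  set g : ℂ → ℂ := fun z => 1 - Complex.exp (-(r * z)) with hg
  have hrC : (r : ℂ) ≠ 0 := by exact_mod_cast hr.ne'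
  obtain ⟨δ, hδ, hδ1, hδr⟩ : ∃ δ > 0, δ ≤ 1 ∧ r * (1 + δ) ^ 2 < 1 := by
    have hc : Tendsto (fun d : ℝ => r * (1 + d) ^ 2) (𝓝[>] 0) (𝓝 (r * (1 + 0) ^ 2)) :=
      ((by fun_prop : Continuous fun d : ℝ => r * (1 + d) ^ 2).tendsto 0).mono_left
        nhdsWithin_le_nhds
    have h1 := hc.eventually (gt_mem_nhds (show r * (1 + 0) ^ 2 < 1 by simpa using hr1))
    have h2 : ∀ᶠ d : ℝ in 𝓝[>] 0, d ≤ 1 :=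
      nhdsWithin_le_nhds (eventually_le_nhds one_pos)
    obtain ⟨d, ⟨hd, hd2⟩, hd3⟩ := ((h1.and h2).and self_mem_nhdsWithin).exists
    exact ⟨d, hd3, hd2, hd⟩
  set s := r * (1 + δ) with hs
  have hs0 : 0 < s := by positivity
  have hsr : s ^ 2 / r < 1 := by
    rw [div_lt_one hr, hs]
    nlinarith
  have hs1 : s ≤ 1 := by
    rw [div_lt_one hr] at hsr
    nlinarith
  have hg1 : ∀ z : ℂ, ‖z‖ < δ → ‖g z - r * z‖ ≤ r ^ 2 * ‖z‖ ^ 2 := by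
    intro z hz
    have hn : ‖-((r : ℂ) * z)‖ = r * ‖z‖ := by
      rw [norm_neg, norm_mul, Complex.norm_real, Real.norm_of_nonneg hr.le]
    have := Complex.norm_exp_sub_one_sub_id_le (x := -(r * z)) (by
      rw [hn]; nlinarith [norm_nonneg z])
    rw [hn] at this
    have e : g z - r * z = -(Complex.exp (-(r * z)) - 1 - -(r * z)) := by simp only [hg]; ring
    rw [e, norm_neg]
    linarith [mul_pow r ‖z‖ 2]
  have hg2 : ∀ z : ℂ, ‖z‖ < δ → ‖g z‖ ≤ s * ‖z‖ := by
    intro z hz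
    have h1 := hg1 z hz
    have h2 : ‖g z‖ ≤ ‖g z - r * z‖ + ‖(r : ℂ) * z‖ := by
      simpa using norm_add_le (g z - r * z) (r * z)
    rw [norm_mul, Complex.norm_real, Real.norm_of_nonneg hr.le] at h2
    have h3 : r ^ 2 * ‖z‖ ^ 2 ≤ r * δ * ‖z‖ := by
      have : r * ‖z‖ ≤ δ := by nlinarith [norm_nonneg z]
      nlinarith [mul_le_mul_of_nonneg_left this (mul_nonneg hr.le (norm_nonneg z))]
    rw [hs]
    linarith
  have hit : ∀ z : ℂ, ‖z‖ < δ → ∀ n, ‖g^[n] z‖ ≤ s ^ n * ‖z‖ ∧ ‖g^[n] z‖ < δ := by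
    intro z hz n
    induction n with
    | zero => simpa using hz
    | succ n ih =>
      rw [Function.iterate_succ_apply']
      have h1 := hg2 _ ih.2
      refine ⟨h1.trans ?_, h1.trans_lt ?_⟩
      · rw [pow_succ', mul_assoc s]
        exact mul_le_mul_of_nonneg_left ih.1 hs0.le
      · exact (mul_le_of_le_one_left (norm_nonneg _) hs1).trans_lt ih.2
  let T : ℕ → ℂ → ℂ := fun n z => g^[n + 1] z / (r : ℂ) ^ (n + 1) - g^[n] z / (r : ℂ) ^ n
  have hT : ∀ n, ∀ z : ℂ, ‖z‖ < δ → ‖T n z‖ ≤ (s ^ 2 / r) ^ n * (r * ‖z‖ ^ 2) := by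
    intro n z hz
    obtain ⟨h1, h2⟩ := hit z hz n
    have e : T n z = (g (g^[n] z) - r * g^[n] z) / (r : ℂ) ^ (n + 1) := by
      simp only [T]
      rw [Function.iterate_succ_apply']
      field_simp
      ring_nf
    rw [e, norm_div, norm_pow, Complex.norm_real, Real.norm_of_nonneg hr.le,
      div_le_iff₀ (by positivity)]
    have h3 := hg1 _ h2
    have h4 : ‖g^[n] z‖ ^ 2 ≤ (s ^ n * ‖z‖) ^ 2 := by gcongr
    calc _ ≤ r ^ 2 * (s ^ n * ‖z‖) ^ 2 := h3.trans (by gcongr)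
      _ = _ := by rw [div_pow]; field_simp; ring_nf
  have hsum : Summable fun n => (s ^ 2 / r) ^ n :=
    summable_geometric_of_lt_one (by positivity) hsr
  have hgd : Differentiable ℂ g := by fun_prop
  have hgnd : ∀ n, Differentiable ℂ (g^[n]) := fun n => hgd.iterate n
  have hsumT : ∀ z : ℂ, ‖z‖ < δ → Summable fun n => T n z := fun z hz =>
    Summable.of_norm_bounded (hsum.mul_right _) fun n => hT n z hz
  refine ⟨δ, hδ, fun z => z + ∑' n, T n z, ?_, ⟨(∑' n, (s ^ 2 / r) ^ n) * r, fun z hz => ?_⟩,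
    fun z hz => ?_⟩
  · refine differentiableOn_id.add (Complex.differentiableOn_tsum_of_summable_norm
      (u := fun n => (s ^ 2 / r) ^ n * (r * δ ^ 2)) (hsum.mul_right _) (fun n => ?_)
      Metric.isOpen_ball fun n z hz => ?_)
    · exact (((hgnd (n + 1)).div_const _).sub ((hgnd n).div_const _)).differentiableOn
    · rw [mem_ball_zero_iff] at hz
      refine (hT n z hz).trans ?_
      gcongr
  · rw [mem_ball_zero_iff] at hz
    rw [add_sub_cancel_left, mul_assoc, ← tsum_mul_right]
    exact tsum_of_norm_bounded (hsum.mul_right _).hasSum fun n => hT n z hz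
  · rw [mem_ball_zero_iff] at hz
    have := ((hsumT z hz).hasSum.tendsto_sum_nat).const_add z
    refine this.congr fun n => ?_
    simp only [T]
    rw [Finset.sum_range_sub (fun n => g^[n] z / (r : ℂ) ^ n)]
    simp

theorem isSchroderSolution_koenigs {r : ℝ} (hr : 0 < r) (hr1 : r < 1) :
    IsSchroderSolution r (koenigs r) := by
  obtain ⟨δ, hδ, F, hF, ⟨C, hC⟩, hlim⟩ := exists_complex_koenigs hr hr1
  have hmem : ∀ {x : ℝ}, |x| < δ → (x : ℂ) ∈ Metric.ball (0 : ℂ) δ := fun {x} hx => by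
    rwa [mem_ball_zero_iff, Complex.norm_real, Real.norm_eq_abs]
  have hreal : ∀ x : ℝ, |x| < δ →
      Tendsto (fun n => (poissonMap r)^[n] x / r ^ n) atTop (𝓝 (F x).re) := by
    intro x hx
    have := (Complex.continuous_re.tendsto _).comp (hlim x (hmem hx))
    refine this.congr fun n => ?_
    simp only [Function.comp_apply]
    rw [← cast_poissonMap_iterate, ← Complex.ofReal_pow, ← Complex.ofReal_div, Complex.ofReal_re]
  have hanF : ∀ x : ℝ, |x| < δ → AnalyticAt ℝ (fun x : ℝ => (F x).re) x := by
    intro x hx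
    exact (hF.analyticAt (Metric.isOpen_ball.mem_nhds (hmem hx))).re_ofReal
  refine ⟨fun x hx => ?_, fun x hx => ?_, ?_⟩
  · obtain ⟨N, hN⟩ := ((tendsto_poissonMap_iterate hr hr1 hx).eventually (gt_mem_nhds hδ)).exists
    have hN0 := poissonMap_iterate_nonneg hr hx N
    have hc : Continuous ((poissonMap r)^[N]) := (continuous_poissonMap r).iterate N
    have hnear : ∀ᶠ z in 𝓝 x, |(poissonMap r)^[N] z| < δ :=
      (hc.abs.tendsto x).eventually (gt_mem_nhds (by rwa [abs_of_nonneg hN0]))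
    have hiter : ∀ N, AnalyticAt ℝ ((poissonMap r)^[N]) x := by
      intro N
      induction N with
      | zero => exact analyticAt_id
      | succ N ih =>
        rw [Function.iterate_succ']
        refine AnalyticAt.comp (g := poissonMap r) ?_ ih
        unfold poissonMap
        fun_prop
    have han : AnalyticAt ℝ (fun z => (F ((poissonMap r)^[N] z : ℝ)).re / r ^ N) x := by
      have := (hanF _ (by rwa [abs_of_nonneg hN0] : |(poissonMap r)^[N] x| < δ)).comp (hiter N)
      exact this.div_const
    refine han.congr ?_
    filter_upwards [hnear] with z hz
    exact (koenigs_iterate_of_tendsto N (hreal _ hz)).limUnder_eq.symm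
  · have := koenigs_iterate hr hr1 hx 1
    simpa [poissonMap] using this
  · refine HasDerivAt.deriv ?_
    rw [hasDerivAt_iff_isLittleO]
    have hval : ∀ x : ℝ, |x| < δ → koenigs r x = (F x).re := fun x hx => (hreal x hx).limUnder_eq
    have hb : ∀ x : ℝ, |x| < δ → |koenigs r x - x| ≤ C * |x| ^ 2 := by
      intro x hx
      have h1 := hC x (hmem hx)
      rw [Complex.norm_real, Real.norm_eq_abs] at h1
      rw [hval x hx]
      have h2 := Complex.abs_re_le_norm (F x - x)
      simp only [Complex.sub_re, Complex.ofReal_re] at h2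
      exact h2.trans h1
    have h0 : koenigs r 0 = 0 := by
      have := hb 0 (by simpa using hδ)
      simpa using this
    have hO : (fun x => koenigs r x - x) =O[𝓝 0] fun x : ℝ => x ^ 2 := by
      refine Asymptotics.IsBigO.of_bound C ?_
      filter_upwards [Metric.ball_mem_nhds (0 : ℝ) hδ] with x hx
      rw [mem_ball_zero_iff, Real.norm_eq_abs] at hx
      simpa using hb x hx
    have ho : (fun x : ℝ => x ^ 2) =o[𝓝 0] fun x : ℝ => x := by
      have := Asymptotics.isLittleO_pow_pow (𝕜 := ℝ) (m := 1) (n := 2) (by norm_num)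
      simpa using this
    simpa [h0] using hO.trans_isLittleO ho

theorem IsSchroderSolution.eqOn_koenigs {r : ℝ} (hr : 0 < r) (hr1 : r < 1) {φ : ℝ → ℝ}
    (h : IsSchroderSolution r φ) : EqOn φ (koenigs r) (Ici 0) := by
  have h0 : φ 0 = 0 := by
    have := h.equation 0 le_rfl
    simp only [mul_zero, neg_zero, Real.exp_zero, sub_self] at this
    nlinarith
  have hd : HasDerivAt φ 1 0 := by
    rw [← h.deriv_zero]
    exact (h.analytic 0 (mem_Ici.2 le_rfl)).differentiableAt.hasDerivAt
  intro x hx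
  rcases (mem_Ici.1 hx).eq_or_lt with rfl | hx
  · rw [h0]
    have := abs_koenigs_sub_le hr hr1 (le_refl (0 : ℝ))
    simp at this
    linarith
  have hiter : ∀ n, φ ((poissonMap r)^[n] x) = r ^ n * φ x := by
    intro n
    induction n with
    | zero => simp
    | succ n ih =>
      rw [Function.iterate_succ_apply', poissonMap,
        h.equation _ (poissonMap_iterate_nonneg hr hx.le n), ih, pow_succ]
      ring
  have hz := tendsto_poissonMap_iterate hr hr1 hx.le
  have hz' : Tendsto (fun n => (poissonMap r)^[n] x) atTop (𝓝[≠] 0) :=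
    tendsto_nhdsWithin_iff.2 ⟨hz, Eventually.of_forall fun n =>
      (poissonMap_iterate_pos hr hx n).ne'⟩
  have h1 := (hasDerivAt_iff_tendsto_slope.1 hd).comp hz'
  have h2 := h1.mul (tendsto_koenigs hr hr1 hx.le)
  rw [one_mul] at h2
  refine tendsto_nhds_unique ?_ h2
  refine tendsto_const_nhds.congr fun n => ?_
  have hne := (poissonMap_iterate_pos hr hx n).ne'
  simp only [Function.comp_apply, slope_def_field, h0, sub_zero, hiter]
  field_simp

theorem abs_poissonMap_iterate_sub_le {r : ℝ} (hr : 0 < r) (hr1 : r < 1) (h : ℕ) :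
    |(poissonMap r)^[h + 1] 1 - koenigs r 1 * r ^ (h + 1)| ≤ r ^ (2 * h) / (1 - r) := by
  set q := (poissonMap r)^[h + 1] 1 with hq
  have hq0 : 0 ≤ q := poissonMap_iterate_nonneg hr zero_le_one _
  have hq1 : q ≤ r ^ (h + 1) := by
    have := poissonMap_iterate_le hr 1 (h + 1)
    rwa [mul_one] at this
  have h1 := abs_koenigs_sub_le hr hr1 hq0
  rw [hq, koenigs_iterate hr hr1 zero_le_one, ← hq, mul_comm] at h1
  refine h1.trans ?_
  have h2 : (0 : ℝ) < 1 - r := by linarith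
  rw [div_le_div_iff₀ (by positivity) h2]
  have h3 : r * q ^ 2 ≤ r ^ (2 * h) := by
    calc r * q ^ 2 ≤ 1 * (r ^ (h + 1)) ^ 2 := by gcongr
      _ = r ^ (2 * h) * r ^ 2 := by ring
      _ ≤ r ^ (2 * h) * 1 := by gcongr; exact pow_le_one₀ hr.le hr1.le
      _ = _ := mul_one _
  nlinarith [mul_nonneg h2.le (sub_nonneg.2 h3), mul_nonneg h2.le (pow_pos hr (2 * h)).le]

end Schroder

section Critical

theorem two_sub_mul_exp_le {x : ℝ} (hx : 0 ≤ x) : (2 - x) * Real.exp x ≤ 2 + x := by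
  have hd : ∀ x : ℝ, HasDerivAt (fun x => 2 + x - (2 - x) * Real.exp x)
      (1 - (-1 * Real.exp x + (2 - x) * Real.exp x)) x := fun x =>
    ((hasDerivAt_id x).const_add 2).sub
      (((hasDerivAt_id x).const_sub 2).mul (Real.hasDerivAt_exp x))
  have hmono : MonotoneOn (fun x => 2 + x - (2 - x) * Real.exp x) (Ici 0) := by
    refine monotoneOn_of_deriv_nonneg (convex_Ici 0)
      (fun t _ => (hd t).continuousAt.continuousWithinAt)
      (fun t _ => (hd t).differentiableAt.differentiableWithinAt) fun t _ => ?_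
    rw [(hd t).deriv]
    have h1 := Real.one_sub_le_exp_neg t
    have h2 : Real.exp (-t) * Real.exp t = 1 := by rw [← Real.exp_add]; simp
    nlinarith [Real.exp_pos t]
  have := hmono (mem_Ici.2 le_rfl) (mem_Ici.2 hx) hx
  simp only [Real.exp_zero] at this
  linarith

theorem inv_poissonMap_ge {x : ℝ} (hx : 0 < x) : x⁻¹ + 1 / 2 ≤ (poissonMap 1 x)⁻¹ := by
  have h1 := two_sub_mul_exp_le hx.le
  have hp := poissonMap_pos one_pos hx
  have h2 : (2 + x) * poissonMap 1 x ≤ 2 * x := by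
    simp only [poissonMap, one_mul]
    have h3 : Real.exp (-x) * Real.exp x = 1 := by rw [← Real.exp_add]; simp
    have h4 : 2 - x ≤ (2 + x) * Real.exp (-x) := by
      have := mul_le_mul_of_nonneg_right h1 (Real.exp_pos (-x)).le
      rw [mul_assoc, mul_comm (Real.exp x), h3, mul_one] at this
      exact this
    linarith
  rw [le_inv_comm₀ (by positivity) hp]
  have : (x⁻¹ + 1 / 2)⁻¹ = 2 * x / (2 + x) := by field_simp
  rw [this, le_div_iff₀ (by positivity)]
  linarith

theorem inv_poissonMap_le {x : ℝ} (hx : 0 < x) (hx1 : x ≤ 1) :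
    (poissonMap 1 x)⁻¹ ≤ x⁻¹ + 1 / 2 + x / 2 := by
  have h1 := le_poissonMap (r := 1) (x := x) (by linarith)
  rw [one_mul] at h1
  have hp := poissonMap_pos one_pos hx
  rw [inv_le_iff_one_le_mul₀ hp]
  have h2 : 0 < x⁻¹ + 1 / 2 + x / 2 := by positivity
  have h3 : (x⁻¹ + 1 / 2 + x / 2) * (x - x ^ 2 / 2) = 1 + x ^ 2 / 4 * (1 - x) := by
    field_simp; ring
  have h4 : 0 ≤ x ^ 2 / 4 * (1 - x) := mul_nonneg (by positivity) (by linarith)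
  nlinarith

theorem poissonMap_one_iterate_bounds (n : ℕ) :
    0 < (poissonMap 1)^[n] 1 ∧ (poissonMap 1)^[n] 1 ≤ 1 ∧
      1 + n / 2 ≤ ((poissonMap 1)^[n] 1)⁻¹ ∧
      ((poissonMap 1)^[n] 1)⁻¹ ≤ 1 + n / 2 + Real.log (n + 1) := by
  have hpos := fun n => poissonMap_iterate_pos one_pos (x := 1) one_pos n
  have hle : ∀ n, (poissonMap 1)^[n] 1 ≤ 1 := fun n => by
    simpa using poissonMap_iterate_le one_pos 1 n
  refine ⟨hpos n, hle n, ?_⟩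
  induction n with
  | zero => simp
  | succ n ih =>
    obtain ⟨ih1, ih2⟩ := ih
    have h1 := inv_poissonMap_ge (hpos n)
    have h2 := inv_poissonMap_le (hpos n) (hle n)
    rw [Function.iterate_succ_apply']
    set x := (poissonMap 1)^[n] 1
    have hx : 0 < x := hpos n
    push_cast
    refine ⟨by linarith, ?_⟩
    have h3 : x / 2 ≤ 1 / (n + 2) := by
      have : x ≤ (1 + (n : ℝ) / 2)⁻¹ := by
        rwa [le_inv_comm₀ hx (by positivity)]
      have e : (1 + (n : ℝ) / 2)⁻¹ = 2 * (1 / (n + 2)) := by field_simp; ring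
      linarith
    have h4 : 1 / ((n : ℝ) + 2) ≤ Real.log (n + 1 + 1) - Real.log (n + 1) := by
      rw [← Real.log_div (by positivity) (by positivity)]
      have := Real.one_sub_inv_le_log_of_pos (x := ((n : ℝ) + 1 + 1) / (n + 1)) (by positivity)
      refine le_trans (le_of_eq ?_) this
      field_simp
      ring
    linarith

theorem abs_poissonMap_one_iterate_sub_le {h : ℕ} (hh : 2 ≤ h) :
    |(poissonMap 1)^[h + 1] 1 - 2 / (h : ℝ)| ≤ 20 * (Real.log h / (h : ℝ) ^ 2) := by
  obtain ⟨hq, -, h1, h2⟩ := poissonMap_one_iterate_bounds (h + 1)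
  set q := (poissonMap 1)^[h + 1] 1
  have hh' : (2 : ℝ) ≤ h := by exact_mod_cast hh
  push_cast at h1 h2
  have hl2 : 1 / 2 ≤ Real.log h := by
    have h3 := Real.log_two_gt_d9
    have h4 := Real.log_le_log two_pos hh'
    linarith
  have hl : Real.log (h + 1 + 1) ≤ 2 * Real.log h := by
    have : Real.log ((h : ℝ) ^ 2) = 2 * Real.log h := by rw [Real.log_pow]; norm_num
    rw [← this]
    refine Real.log_le_log (by positivity) (by nlinarith)
  set a := q⁻¹ with ha
  have hqa : q = a⁻¹ := by rw [ha, inv_inv]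
  have ha0 : 0 < a := inv_pos.2 hq
  have e : q - 2 / (h : ℝ) = -((a - h / 2) * (2 / h) * a⁻¹) := by
    rw [hqa]; field_simp; ring
  have h5 : 0 ≤ a - h / 2 := by linarith
  have h6 : a - h / 2 ≤ 5 * Real.log h := by linarith
  have h7 : a⁻¹ ≤ 2 / h := by
    rw [inv_le_comm₀ ha0 (by positivity), inv_div]
    linarith
  rw [e, abs_neg, abs_of_nonneg (by positivity)]
  calc (a - h / 2) * (2 / h) * a⁻¹ ≤ (5 * Real.log h) * (2 / h) * (2 / h) := by gcongr
    _ = _ := by ring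

end Critical

section Main

theorem isLeast_pos {lam mu r : ℝ} (hlam : 0 < lam) (hmu : 0 < mu)
    (hr : IsLeast {x : ℝ | x * Real.exp (-x) = lam / mu} r) : 0 < r := by
  have h1 : r * Real.exp (-r) = lam / mu := hr.1
  have h2 : 0 < r * Real.exp (-r) := by rw [h1]; positivity
  exact pos_of_mul_pos_left h2 (Real.exp_pos _).le

theorem isLeast_le_one {lam mu r : ℝ} (hlam : 0 < lam) (hmu : 0 < mu)
    (hle : lam / mu ≤ Real.exp (-1))
    (hr : IsLeast {x : ℝ | x * Real.exp (-x) = lam / mu} r) : r ≤ 1 := by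
  have hρ : 0 < lam / mu := by positivity
  obtain ⟨x, hx, hxe⟩ := intermediate_value_Icc (f := fun x : ℝ => x * Real.exp (-x))
    (zero_le_one (α := ℝ)) (by fun_prop) (show lam / mu ∈ Icc _ _ by
      simp only [zero_mul, one_mul]
      exact ⟨hρ.le, hle⟩)
  exact (hr.2 hxe).trans hx.2

theorem eq_one_of_mul_exp_neg_eq {r : ℝ} (h : r * Real.exp (-r) = Real.exp (-1)) : r = 1 := by
  by_contra hne
  have h1 := Real.add_one_lt_exp (sub_ne_zero.2 hne)
  have h2 : Real.exp (r - 1) = Real.exp (-1) / Real.exp (-r) := by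
    rw [← Real.exp_sub]; ring_nf
  rw [h2, ← h] at h1
  have := (Real.exp_pos (-r)).ne'
  field_simp at h1
  linarith

/-- The law on `ℕ` with prescribed tails. -/
theorem exists_measure_of_tails {q : ℕ → ℝ} (hq : Antitone q) (hq1 : q 0 ≤ 1)
    (hlim : Tendsto q atTop (𝓝 0)) :
    ∃ ν : Measure ℕ, IsProbabilityMeasure ν ∧ ν.real {0} = 1 - q 0 ∧
      (∀ n, ν.real {n + 1} = q n - q (n + 1)) ∧ ∀ n, ν.real (Ioi n) = q n := by
  let p : ℕ → ℝ := fun n => Nat.casesOn n (1 - q 0) fun n => q n - q (n + 1)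
  have hp : ∀ n, 0 ≤ p n := by
    rintro (_ | n)
    · simpa [p] using hq1
    · simpa [p] using hq (Nat.le_succ n)
  have hsum : ∀ n, ∑ i ∈ Finset.range (n + 1), p i = 1 - q n := by
    intro n
    induction n with
    | zero => simp [p]
    | succ n ih => rw [Finset.sum_range_succ, ih]; simp only [p]; ring
  have hhas : HasSum p 1 := by
    rw [hasSum_iff_tendsto_nat_of_nonneg hp, ← tendsto_add_atTop_iff_nat 1]
    simp only [hsum]
    simpa using hlim.const_sub 1
  let π : PMF ℕ := ⟨fun n => ENNReal.ofReal (p n), by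
    have := ENNReal.summable.hasSum (f := fun n => ENNReal.ofReal (p n))
    rwa [← ENNReal.ofReal_tsum_of_nonneg hp hhas.summable, hhas.tsum_eq,
      ENNReal.ofReal_one] at this⟩
  have hsing : ∀ n, π.toMeasure.real {n} = p n := fun n => by
    rw [Measure.real, PMF.toMeasure_apply_singleton _ _ (measurableSet_singleton n)]
    exact ENNReal.toReal_ofReal (hp n)
  refine ⟨π.toMeasure, inferInstance, hsing 0, fun n => hsing (n + 1), fun n => ?_⟩
  have hc : (Ioi n : Set ℕ) = ((Finset.range (n + 1) : Finset ℕ) : Set ℕ)ᶜ := by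
    ext k; simp
  rw [hc, probReal_compl_eq_one_sub (Finset.measurableSet _), ← sum_measureReal_singleton]
  simp only [hsing, hsum]
  ring

/-- Convergence in distribution of integer-valued random variables follows from the convergence
of the distribution functions. -/
theorem tendstoInDistribution_of_tendsto_cdf {Ω : Type*} {mΩ : MeasurableSpace Ω}
    {P : Measure Ω} [IsProbabilityMeasure P] {X : ℝ≥0 → Ω → ℕ} (hX : ∀ t, Measurable (X t))
    {q : ℕ → ℝ} {ν : Measure ℕ} [IsProbabilityMeasure ν] (h0 : ν.real {0} = 1 - q 0)
    (hs : ∀ n, ν.real {n + 1} = q n - q (n + 1))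
    (h : ∀ n, Tendsto (fun t => P.real {ω | X t ω ≤ n}) atTop (𝓝 (1 - q n))) :
    TendstoInDistribution X atTop (id : ℕ → ℕ) (fun _ => P) ν := by
  refine ⟨fun t => (hX t).aemeasurable, measurable_id.aemeasurable, ?_⟩
  have hpi : IsPiSystem {s : Set ℕ | ∃ n, s = {n}} := by
    rintro _ ⟨m, rfl⟩ _ ⟨n, rfl⟩ ⟨k, hk⟩
    simp only [mem_inter_iff, mem_singleton_iff] at hk
    obtain ⟨rfl, rfl⟩ := hk
    exact ⟨k, inter_self _⟩
  refine hpi.tendsto_probabilityMeasure_of_tendsto_of_mem ?_ ?_ ?_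
  · rintro _ ⟨n, rfl⟩
    exact measurableSet_singleton n
  · intro u _ x hx
    exact ⟨{x}, ⟨x, rfl⟩, by simp, by simpa using hx⟩
  · rintro _ ⟨n, rfl⟩
    rw [← NNReal.tendsto_coe]
    have e1 : ∀ t, (P.map (X t)).real {n} = P.real {ω | X t ω = n} := fun t => by
      rw [map_measureReal_apply (hX t) (measurableSet_singleton n)]
      rfl
    change Tendsto (fun t => (P.map (X t)).real {n}) atTop (𝓝 ((ν.map id).real {n}))
    simp only [e1, Measure.map_id]
    rcases n with _ | n
    · rw [h0]
      simpa using h 0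
    · rw [hs]
      have h1 := (h (n + 1)).sub (h n)
      rw [sub_sub_sub_cancel_left] at h1
      refine h1.congr fun t => ?_
      have e2 : {ω | X t ω ≤ n + 1} = {ω | X t ω ≤ n} ∪ {ω | X t ω = n + 1} := by
        ext ω; simp only [mem_union, mem_ofPred_eq]; omega
      rw [e2, measureReal_union]
      · ring
      · rw [Set.disjoint_left]
        intro ω h1 h2
        simp only [mem_ofPred_eq] at h1 h2
        omega
      · exact hX t (measurableSet_singleton (n + 1))

end Main

theorem theorem3p2 :
    ∃ (θ : ℝ → ℝ → ℝ) (C : ℝ),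
      (∀ r : ℝ, 0 < r → r < 1 →
        IsSchroderSolution r (θ r) ∧
        (∀ φ : ℝ → ℝ, IsSchroderSolution r φ → EqOn φ (θ r) (Ici 0)) ∧
        0 < θ r 1) ∧
      ∀ (lam mu r : ℝ), 0 < lam → 0 < mu → lam / mu ≤ Real.exp (-1) →
        IsLeast {x : ℝ | x * Real.exp (-x) = lam / mu} r →
        ∀ (Ω : Type*) (mΩ : MeasurableSpace Ω) (P : Measure Ω) (_ : IsProbabilityMeasure P)
          (G : ℝ≥0 → Ω → RTree), IsTreeChain P lam mu G →
          ∃ (ν : Measure ℕ) (_ : IsProbabilityMeasure ν),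
            TendstoInDistribution (fun (t : ℝ≥0) (ω : Ω) => (G t ω).height) atTop (id : ℕ → ℕ)
              (fun _ => P) ν ∧
            ν.real {0} = Real.exp (-r) ∧
            (∀ h : ℕ, ν.real (Ioi (h + 1)) = 1 - Real.exp (-(r * ν.real (Ioi h)))) ∧
            (lam / mu < Real.exp (-1) →
              ∀ h : ℕ, |ν.real (Ioi h) - θ r 1 * r ^ (h + 1)| ≤ C * (r ^ (2 * h) / (1 - r))) ∧
            (lam / mu = Real.exp (-1) →
              ∀ h : ℕ, 2 ≤ h →
                |ν.real (Ioi h) - 2 / (h : ℝ)| ≤ C * (Real.log h / (h : ℝ) ^ 2)) := by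
  refine ⟨koenigs, 20, fun r hr hr1 => ⟨isSchroderSolution_koenigs hr hr1,
    fun φ hφ => hφ.eqOn_koenigs hr hr1, koenigs_pos hr hr1 one_pos⟩, ?_⟩
  intro lam mu r hlam hmu hle hr Ω mΩ P _ G hG
  have hr0 := isLeast_pos hlam hmu hr
  have hr1 := isLeast_le_one hlam hmu hle hr
  have hroot : r * Real.exp (-r) = lam / mu := hr.1
  set q : ℕ → ℝ := fun n => (poissonMap r)^[n + 1] 1 with hq
  have hqs : ∀ n, q (n + 1) = poissonMap r (q n) := fun n => Function.iterate_succ_apply' _ _ _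
  have hqpos : ∀ n, 0 < q n := fun n => poissonMap_iterate_pos hr0 one_pos _
  have hq0 : 1 - q 0 = Real.exp (-r) := by simp [hq, poissonMap]
  have hanti : Antitone q := antitone_nat_of_succ_le fun n => by
    rw [hqs]
    exact (poissonMap_le _ _).trans (mul_le_of_le_one_left (hqpos n).le hr1)
  have hqlim : Tendsto q atTop (𝓝 0) := by
    rcases hr1.lt_or_eq with hr1 | rfl
    · exact (tendsto_add_atTop_iff_nat 1).2 (tendsto_poissonMap_iterate hr0 hr1 zero_le_one)
    · have h1 : Tendsto (fun n : ℕ => (2 : ℝ) * (1 / ((n : ℝ) + 1))) atTop (𝓝 (2 * 0)) :=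
        tendsto_one_div_add_atTop_nhds_zero_nat.const_mul 2
      rw [mul_zero] at h1
      refine squeeze_zero (fun n => (hqpos n).le) (fun n => ?_) h1
      obtain ⟨h2, -, h3, -⟩ := poissonMap_one_iterate_bounds (n + 1)
      push_cast at h3
      rw [le_inv_comm₀ (by positivity) h2] at h3
      refine h3.trans ?_
      rw [inv_le_iff_one_le_mul₀ (by positivity)]
      field_simp
      linarith
  obtain ⟨ν, hν, hν0, hνs, hνt⟩ := exists_measure_of_tails hanti
    (by linarith [Real.exp_pos (-r)]) hqlim
  obtain ⟨y, hy⟩ := exists_isRates hlam hmu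
  have hlimit : ∀ n, Tendsto (expInt lam (y n)) atTop (𝓝 (1 - q n)) := by
    intro n
    induction n with
    | zero =>
      rw [hq0]
      exact hy.tendsto_expInt_zero hlam hmu hr0 hr
    | succ n ih =>
      have := hy.tendsto_expInt_succ hlam hmu hr0 hr ih
      rwa [sub_sub_cancel, show Real.exp (-(r * q n)) = 1 - q (n + 1) by
        rw [hqs, poissonMap]; ring] at this
  refine ⟨ν, hν, ?_, by rw [hν0, hq0], fun h => ?_, fun hlt h => ?_, fun heq h hh => ?_⟩
  · refine tendstoInDistribution_of_tendsto_cdf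
      (fun t => (measurable_from_top (f := RTree.height)).comp (hG.measurable_chain t)) hν0 hνs
      fun n => ?_
    exact ((hlimit n).comp (NNReal.tendsto_coe_atTop.2 tendsto_id)).congr fun t =>
      (hG.prob_height_le hlam hmu hy n t).symm
  · rw [hνt, hνt, hqs, poissonMap]
  · have hr1' : r < 1 := by
      refine lt_of_le_of_ne hr1 ?_
      rintro rfl
      rw [one_mul] at hroot
      linarith
    rw [hνt]
    refine (abs_poissonMap_iterate_sub_le hr0 hr1' h).trans ?_
    have : 0 ≤ r ^ (2 * h) / (1 - r) := div_nonneg (by positivity) (by linarith)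
    linarith
  · have : r = 1 := eq_one_of_mul_exp_neg_eq (hroot.trans heq)
    rw [hνt, hq, this]
    exact abs_poissonMap_one_iterate_sub_le hh
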